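/- **Structures.** All structures are finite, nonempty, ordered and arithmetic: besides its own finitely many relation symbols, a signature contains $<$, $\mathrm{add}$, $\mathrm{mult}$, $\mathrm{succ}$ and $0$, where $<$ is interpreted as a linear order on the universe and the other symbols have their natural meaning with respect to it (when the elements are identified with $0,1,\dots,n$ in increasing order; the successor of the maximum is the maximum itself). Let $\mathrm{Struc}[\tau]$ be the class of these $\tau$-structures. **Hitting set.** Let $\tau_{\mathrm{hyper}}$ be the arithmetic signature with the additional relation symbols $\mathrm{vertex}$ (unary), $\mathrm{hyperedge}$ (unary) and $\mathrm{in}$ (binary). For $\mathcal H\in\mathrm{Struc}[\tau_{\mathrm{hyper}}]$ put $\mathrm{set}(e)=\{v \mid (v,e)\in \mathrm{in}^{\mathcal H}\}$, $V=\mathrm{vertex}^{\mathcal H}$, $E=\{\mathrm{set}(e)\mid e\in \mathrm{hyperedge}^{\mathcal H}\}$ and $H(\mathcal H)=(V,E)$. With $\mathrm{num}(k,d)$ a computable bijective coding of pairs of natural numbers by natural numbers (the Cantor-style pairing of Mathlib), $p_{k,d}$-hitting-set is the set of all pairs $(\mathcal H,\mathrm{num}(k,d))$ such that $H(\mathcal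 H)$ is a hypergraph (every member of $E$ is a subset of $V$), $|e|\le d$ for all $e\in E$, and there is $X\subseteq V$ with $|X|\le k$ and $X\cap e\neq\emptyset$ for all $e\in E$. The problem $p_{k,d}$-hitting-set$'$ is the set of those $(\mathcal H,\mathrm{num}(k,d))$ in $p_{k,d}$-hitting-set such that for every $e\in\mathrm{hyperedge}^{\mathcal H}$ and every $s\subseteq\mathrm{set}(e)$ there is an element $e'$ of the universe of $\mathcal H$ with $\mathrm{set}(e')=s$. **Bounded rank reductions.** A first-order query of width $w$ from $\tau$-structures to $\tau'$-structures consists of a $\tau$-formula $\phi_{\mathrm{universe}}(x_1,\dots,x_w)$ and, for every symbol of $\tau'$ (including the arithmetic ones; functions and constants through their graphs), a $\tau$-formula with $w$ variables per argument, such that for every $\mathcal A\in\mathrm{Struc}[\tau]$ they define a structure $f(\mathcal A)\in\mathrm{Struc}[\tau']$ whose universe is the set of $w$-tuples satisfying $\phi_{\mathrm{universe}}$. A bounded rank reduction from $Q\subseteq\mathrm{Struc}[\tau]\times\mathbb N$ to $Q'\subseteq\mathrm{Struc}[\tau']\times\mathbb N$ is a pair of computable families $(f_p)_{p\in\mathbb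 N}$ of first-order queries from $\tau$-structures to $\tau'$-structures and $(\iota_{p,p'})_{p,p'\in\mathbb N}$ of $\tau$-sentences such that 1. for all $\mathcal A\in\mathrm{Struc}[\tau]$ and $p\in\mathbb N$ there is exactly one $p'$, denoted $\iota_p(\mathcal A)$, with $\mathcal A\models\iota_{p,p'}$; 2. there is a computable $\iota^*\colon\mathbb N\to\mathbb N$ with $\iota_p(\mathcal A)\le\iota^*(p)$ for all $\mathcal A$ and $p$; 3. $(\mathcal A,p)\in Q$ if and only if $(f_p(\mathcal A),\iota_p(\mathcal A))\in Q'$; 4. the quantifier ranks of all $\iota_{p,p'}$ and of all formulas in the $f_p$, and the widths of the $f_p$, are bounded by one constant $c$. **Lemma.** There is a bounded rank reduction from $p_{k,d}$-hitting-set to $p_{k,d}$-hitting-set$'$ (that is, $p_{k,d}\text{-hitting-set}\le_{\mathrm{br}}p_{k,d}\text{-hitting-set}'$), and it can be chosen such that all its queries have width $2$. -/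

import Mathlib

/-! ## Arithmetic signatures and finite arithmetic structures -/

/-- A finite list of relation symbols with their arities (the non-arithmetic part of a
signature). -/
structure Vocabulary where
  /-- number of relation symbols -/
  numRel : ℕ
  /-- arity of each relation symbol -/
  arity : Fin numRel → ℕ

/-- The function symbols of an arithmetic signature: the constant `0` and the unary `succ`. -/
inductive ArithFunc : ℕ → Type
  | zero : ArithFunc 0
  | succ : ArithFunc 1

/-- The relation symbols of an arithmetic signature: `<`, `add`, `mult`, and the relation symbols of
the vocabulary `σ`. -/
inductive ArithRel (σ : Vocabulary) : ℕ → Type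
  | lt : ArithRel σ 2
  | add : ArithRel σ 3
  | mult : ArithRel σ 3
  | sym (i : Fin σ.numRel) : ArithRel σ (σ.arity i)

/-- The arithmetic signature over `σ`, as a first-order language. -/
@[reducible] def arithLang (σ : Vocabulary) : FirstOrder.Language where
  Functions := ArithFunc
  Relations := ArithRel σ

/-- `M` is finite and nonempty, `<` is interpreted by a linear order on `M`, and the other arithmetic
symbols have their natural meaning relative to this order, where the successor of the maximum is the
maximum itself. The bijection `e` maps each element to its position in the order. -/
def IsArithmetic (σ : Vocabulary) (M : Type) [(arithLang σ).Structure M] : Prop :=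
  ∃ (n : ℕ) (e : M ≃ Fin (n + 1)),
    (∀ x y : M, FirstOrder.Language.Structure.RelMap (L := arithLang σ) ArithRel.lt ![x, y] ↔
      e x < e y) ∧
    (∀ x y z : M, FirstOrder.Language.Structure.RelMap (L := arithLang σ) ArithRel.add ![x, y, z] ↔
      (e x : ℕ) + (e y : ℕ) = (e z : ℕ)) ∧
    (∀ x y z : M, FirstOrder.Language.Structure.RelMap (L := arithLang σ) ArithRel.mult ![x, y, z] ↔
      (e x : ℕ) * (e y : ℕ) = (e z : ℕ)) ∧
    (e (FirstOrder.Language.Structure.funMap (L := arithLang σ) ArithFunc.zero ![]) : ℕ) = 0 ∧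
    (∀ x : M, (e (FirstOrder.Language.Structure.funMap (L := arithLang σ) ArithFunc.succ ![x]) : ℕ) =
      min ((e x : ℕ) + 1) n)

/-- The class of all (finite, ordered) structures over the arithmetic signature of `σ`. -/
structure Struc (σ : Vocabulary) where
  /-- the universe of the structure -/
  carrier : Type
  [str : (arithLang σ).Structure carrier]
  isArithmetic : IsArithmetic σ carrier

attribute [instance] Struc.str

/-- A parameterized problem over `σ`: a set of pairs of a structure and a parameter value. -/
abbrev ParamProblem (σ : Vocabulary) := Set (Struc σ × ℕ)

/-! ## Quantifier rank and Gödel numbers of formulas -/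

/-- The quantifier rank: the maximal nesting depth of quantifiers. -/
def quantRank {L : FirstOrder.Language} {α : Type} : {n : ℕ} → L.BoundedFormula α n → ℕ
  | _, .falsum => 0
  | _, .equal _ _ => 0
  | _, .rel _ _ => 0
  | _, .imp φ ψ => max (quantRank φ) (quantRank ψ)
  | _, .all φ => quantRank φ + 1

/-- The number of a function symbol. -/
def funcCode : {n : ℕ} → ArithFunc n → ℕ
  | _, .zero => 0
  | _, .succ => 1

/-- The number of a relation symbol. -/
def relCode {σ : Vocabulary} : {n : ℕ} → ArithRel σ n → ℕ
  | _, .lt => 0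
  | _, .add => 1
  | _, .mult => 2
  | _, .sym i => 3 + i

/-- The Gödel number of a term. -/
def termCode {σ : Vocabulary} {α : Type} [Encodable α] : (arithLang σ).Term α → ℕ
  | .var a => Nat.pair 0 (Encodable.encode a)
  | .func F ts =>
    Nat.pair (1 + funcCode F) (Encodable.encode (List.ofFn fun i => termCode (ts i)))

/-- The Gödel number of a formula. -/
def formulaCode {σ : Vocabulary} {α : Type} [Encodable α] :
    {n : ℕ} → (arithLang σ).BoundedFormula α n → ℕ
  | _, .falsum => Nat.pair 0 0
  | _, .equal t₁ t₂ => Nat.pair 1 (Nat.pair (termCode t₁) (termCode t₂))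
  | _, .imp φ ψ => Nat.pair 2 (Nat.pair (formulaCode φ) (formulaCode ψ))
  | _, .all φ => Nat.pair 3 (formulaCode φ)
  | _, .rel R ts =>
    Nat.pair (4 + relCode R) (Encodable.encode (List.ofFn fun i => termCode (ts i)))

/-! ## First-order queries -/

/-- The formulas of a first-order query of width `width` from `σ`-structures to `σ'`-structures: a
formula selecting the tuples that form the new universe, and one formula for each symbol of the
arithmetic signature over `σ'`, with `width` variables per argument. An `n`-ary function symbol is
described by its graph, the last argument being the value. -/
structure QueryFormulas (σ σ' : Vocabulary) where
  /-- the width of the query -/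
  width : ℕ
  /-- the formula describing the new universe -/
  univ : (arithLang σ).Formula (Fin width)
  /-- the formulas describing the relations -/
  rel : {n : ℕ} → ArithRel σ' n → (arithLang σ).Formula (Fin n × Fin width)
  /-- the formulas describing the graphs of the functions and constants -/
  func : {n : ℕ} → ArithFunc n → (arithLang σ).Formula (Fin (n + 1) × Fin width)

namespace QueryFormulas

variable {σ σ' : Vocabulary}

/-- The universe of the structure defined in `A`. -/
def Universe (I : QueryFormulas σ σ') (A : Struc σ) : Type :=
  {x : Fin I.width → A.carrier // I.univ.Realize x}

/-- The relation defined in `A` for the symbol `R`. -/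
def Rel (I : QueryFormulas σ σ') (A : Struc σ) {n : ℕ} (R : ArithRel σ' n)
    (xs : Fin n → I.Universe A) : Prop :=
  (I.rel R).Realize fun p => (xs p.1).1 p.2

/-- The graph defined in `A` for the symbol `F`. -/
def Graph (I : QueryFormulas σ σ') (A : Struc σ) {n : ℕ} (F : ArithFunc n)
    (xs : Fin n → I.Universe A) (y : I.Universe A) : Prop :=
  (I.func F).Realize fun p => (Fin.snoc (α := fun _ => I.Universe A) xs y p.1).1 p.2

/-- The graphs defined in `A` are graphs of total functions. -/
def IsFunctional (I : QueryFormulas σ σ') (A : Struc σ) : Prop :=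
  ∀ (n : ℕ) (F : ArithFunc n) (xs : Fin n → I.Universe A), ∃! y, I.Graph A F xs y

/-- The structure defined in `A`. -/
@[reducible] noncomputable def image (I : QueryFormulas σ σ') (A : Struc σ)
    (h : I.IsFunctional A) : (arithLang σ').Structure (I.Universe A) where
  funMap F xs := (h _ F xs).choose
  RelMap R xs := I.Rel A R xs

end QueryFormulas

/-- A first-order query from `σ`-structures to `σ'`-structures: in every (finite arithmetic)
`σ`-structure the formulas define a (finite arithmetic) `σ'`-structure. -/
structure FOQuery (σ σ' : Vocabulary) extends QueryFormulas σ σ' where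
  isFunctional : ∀ A : Struc σ, toQueryFormulas.IsFunctional A
  isArithmetic : ∀ A : Struc σ,
    @IsArithmetic σ' (toQueryFormulas.Universe A) (toQueryFormulas.image A (isFunctional A))

/-- The value of a first-order query on a structure. -/
noncomputable def FOQuery.apply {σ σ' : Vocabulary} (f : FOQuery σ σ') (A : Struc σ) : Struc σ' where
  carrier := f.Universe A
  str := f.image A (f.isFunctional A)
  isArithmetic := f.isArithmetic A

/-- A family of first-order queries is computable: all ingredients of the `k`-th query can be computed
from `k`. (The signature is finite, so there are finitely many ingredients.) -/
def ComputableQueries {σ σ' : Vocabulary} (f : ℕ → FOQuery σ σ') : Prop :=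
  (Computable fun k => (f k).width) ∧
  (Computable fun k => formulaCode (f k).univ) ∧
  (∀ (n : ℕ) (R : ArithRel σ' n), Computable fun k => formulaCode ((f k).rel R)) ∧
  (∀ (n : ℕ) (F : ArithFunc n), Computable fun k => formulaCode ((f k).func F))

/-! ## Bounded rank reductions -/

/-- A bounded rank reduction from `Q` to `Q'`. -/
structure BoundedRankReduction {σ σ' : Vocabulary} (Q : ParamProblem σ) (Q' : ParamProblem σ') where
  /-- the queries `f k` -/
  f : ℕ → FOQuery σ σ'
  /-- the sentences `ι k k'` selecting the new parameter value -/
  ι : ℕ → ℕ → (arithLang σ).Sentence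
  computable_f : ComputableQueries f
  computable_ι : Computable₂ fun k k' => formulaCode (ι k k')
  /-- exactly one new parameter value is selected -/
  existsUnique_param : ∀ (A : Struc σ) (k : ℕ), ∃! k', A.carrier ⊨ ι k k'
  /-- the new parameter value is bounded computably in terms of the old one -/
  param_le : ∃ ιStar : ℕ → ℕ, Computable ιStar ∧
    ∀ (A : Struc σ) (k k' : ℕ), A.carrier ⊨ ι k k' → k' ≤ ιStar k
  /-- correctness -/
  correct : ∀ (A : Struc σ) (k k' : ℕ), A.carrier ⊨ ι k k' →
    ((A, k) ∈ Q ↔ ((f k).apply A, k') ∈ Q')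
  /-- all quantifier ranks and all widths are bounded by a constant -/
  bounded : ∃ c : ℕ,
    (∀ k k', quantRank (ι k k') ≤ c) ∧
    ∀ k, (f k).width ≤ c ∧ quantRank (f k).univ ≤ c ∧
      (∀ (n : ℕ) (R : ArithRel σ' n), quantRank ((f k).rel R) ≤ c) ∧
      (∀ (n : ℕ) (F : ArithFunc n), quantRank ((f k).func F) ≤ c)

/-! ## The hitting set problems -/

/-- The signature of hypergraphs: `vertex` (unary), `hyperedge` (unary), `in` (binary). -/
def hyperVocab : Vocabulary where
  numRel := 3
  arity := ![1, 1, 2]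

/-- the symbol `vertex` -/
def vertexSym : ArithRel hyperVocab 1 := ArithRel.sym (σ := hyperVocab) (0 : Fin 3)

/-- the symbol `hyperedge` -/
def hyperedgeSym : ArithRel hyperVocab 1 := ArithRel.sym (σ := hyperVocab) (1 : Fin 3)

/-- the symbol `in` -/
def inSym : ArithRel hyperVocab 2 := ArithRel.sym (σ := hyperVocab) (2 : Fin 3)

namespace Struc

/-- The vertex set `V` of the hypergraph of `A`. -/
def vertices (A : Struc hyperVocab) : Set A.carrier :=
  {v | FirstOrder.Language.Structure.RelMap (L := arithLang hyperVocab) vertexSym ![v]}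

/-- The elements of `A` that stand for hyperedges. -/
def hyperedges (A : Struc hyperVocab) : Set A.carrier :=
  {e | FirstOrder.Language.Structure.RelMap (L := arithLang hyperVocab) hyperedgeSym ![e]}

/-- The set represented by the element `e`. -/
def set (A : Struc hyperVocab) (e : A.carrier) : Set A.carrier :=
  {v | FirstOrder.Language.Structure.RelMap (L := arithLang hyperVocab) inSym ![v, e]}

/-- The family `E` of hyperedges of the hypergraph of `A`. -/
def edgeFamily (A : Struc hyperVocab) : Set (Set A.carrier) := A.set '' A.hyperedges

end Struc

/-- `X` is a hitting set of the hypergraph `H`. -/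
def IsHittingSet {α : Type} (H : Hypergraph α) (X : Set α) : Prop :=
  X ⊆ H.vertexSet ∧ ∀ e ∈ H.edgeSet, (e ∩ X).Nonempty

/-- The problem `p_{k,d}-hitting-set`, the parameter being the number `Nat.pair k d`: the pair
`(V, E)` given by the structure is a hypergraph `H` (that is, every hyperedge is a subset of `V`), every
hyperedge has at most `d` elements, and `H` has a hitting set of size at most `k`. -/
def hittingSet : ParamProblem hyperVocab :=
  {p | ∃ k d : ℕ, p.2 = Nat.pair k d ∧
    ∃ H : Hypergraph p.1.carrier, H.vertexSet = p.1.vertices ∧ H.edgeSet = p.1.edgeFamily ∧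
      (∀ e ∈ H.edgeSet, e.ncard ≤ d) ∧
      ∃ X : Set p.1.carrier, IsHittingSet H X ∧ X.ncard ≤ k}

/-- The restriction of `hittingSet` to those structures in which every subset of every hyperedge is
represented by an element of the universe. -/
def hittingSet' : ParamProblem hyperVocab :=
  {p | p ∈ hittingSet ∧
    ∀ e ∈ p.1.hyperedges, ∀ s ⊆ p.1.set e, ∃ e' : p.1.carrier, p.1.set e' = s}

/-! Let `n` be the largest position in the input structure. The new universe consists of the pairs
`(a, i)` with `i ≤ √n`, read as two-digit numbers in base `⌊√n⌋ + 1`. With such small second digits,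
the arithmetic of pairs can be arranged so that no intermediate value exceeds `n`, hence it is
definable by fixed formulas (`pairQuery`). The pair `(a, 0)` is a copy of `a`. For `i > 0` the pair
`(e, i)` represents the part of `set(e)` lying in the `i`-th set of one fixed definable family,
`InTrace`. The hypergraph is merely copied, so the parameter stays the same. What has to be shown is
that every subset of a set with at most `d` elements is cut out by some `i ≤ √n`.

Let `e` have at most `d` elements. The product of its pairwise distances is about `n ^ (d * d)` at
most, so some `m` of size `O(d² log n + 1)` does not divide it, and reduction modulo `m` is
injective on `e` (`exists_modulus`). Then Gödel's β-function applies: for a suitable `K` the numbers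
`(r + 1) * K + 1`, for the residues `r` of `e`, are pairwise coprime, a subset is coded by a product
`T` of them, and membership is divisibility (`exists_inTrace_of_modulus`). Everything is bounded by
a power of `m` whose exponent depends on `d` only, so the code is at most `√n` once `traceBound d ≤
n`.

For `n ≤ traceBound d` the instance is decided outright. Numerals are terms, so a disjunction over
all tuples of numerals expresses the existence of a small hitting set with rank 2 (`decisionF`), and
the output is a trivial yes- or no-instance. -/

/-! ## A small definable family of sets that traces out all subsets of small sets -/

/-- Every positive number below `2 ^ t` has a non-divisor of size at most `2 * t`. -/
theorem exists_not_dvd_of_lt_two_pow {P t : ℕ} (hP : 0 < P) (h : P < 2 ^ t) :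
    ∃ m, 2 ≤ m ∧ m ≤ 2 * t ∧ ¬ m ∣ P := by
  by_contra! hc
  have ht : 0 < t := by
    rcases Nat.eq_zero_or_pos t with rfl | ht
    · simp at h; omega
    · exact ht
  -- Each nontrivial exact prime power in `C(2t, t)` is at most `2t`, so it is among the numbers
  -- assumed to divide `P`. As `2 ^ t ≤ C(2t, t)`, this makes `P` too large.
  have hdvd : t.centralBinom ∣ P := by
    rw [← Nat.factorization_prime_le_iff_dvd (Nat.centralBinom_ne_zero t) hP.ne']
    intro p hp
    rw [← hp.pow_dvd_iff_le_factorization hP.ne']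
    rcases Nat.eq_zero_or_pos (t.centralBinom.factorization p) with h0 | h0
    · simp [h0]
    · refine hc _ ?_ ?_
      · calc 2 ≤ p := hp.two_le
          _ = p ^ 1 := (pow_one p).symm
          _ ≤ _ := Nat.pow_le_pow_right hp.pos h0
      · exact Nat.pow_factorization_choose_le (by omega)
  have h2 : ∀ t : ℕ, 2 ^ t ≤ t.centralBinom := by
    intro t
    induction t with
    | zero => simp
    | succ t ih =>
      have := Nat.succ_mul_centralBinom_succ t
      have h3 : (t + 1) * 2 ^ (t + 1) ≤ (t + 1) * (t + 1).centralBinom := by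
        rw [this, pow_succ]
        nlinarith
      exact Nat.le_of_mul_le_mul_left h3 (by omega)
  have := Nat.le_of_dvd hP hdvd
  have := h2 t
  omega

/-- The product of the distances of all pairs of distinct elements of `e`, measured after applying
`f`. -/
def distProd (e : Finset ℕ) (f : ℕ → ℕ) : ℕ := ∏ p ∈ e.offDiag, Nat.dist (f p.1) (f p.2)

theorem dist_dvd_distProd {e : Finset ℕ} (f : ℕ → ℕ) {x y : ℕ} (hx : x ∈ e) (hy : y ∈ e)
    (hxy : x ≠ y) : Nat.dist (f x) (f y) ∣ distProd e f :=
  Finset.dvd_prod_of_mem (fun p : ℕ × ℕ => Nat.dist (f p.1) (f p.2)) (a := (x, y))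
    (by simp [hx, hy, hxy])

theorem distProd_pos {e : Finset ℕ} {f : ℕ → ℕ} (hf : Set.InjOn f e) : 0 < distProd e f := by
  refine Finset.prod_pos fun p hp => ?_
  rw [Finset.mem_offDiag] at hp
  exact Nat.dist_pos_of_ne fun h => hp.2.2 (hf hp.1 hp.2.1 h)

theorem distProd_le {e : Finset ℕ} {f : ℕ → ℕ} {B d : ℕ} (hB : 0 < B) (hf : ∀ x ∈ e, f x ≤ B)
    (hd : e.card ≤ d) : distProd e f ≤ B ^ (d * d) := by
  calc distProd e f ≤ B ^ e.offDiag.card := by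
        refine Finset.prod_le_pow_card _ _ _ fun p hp => ?_
        rw [Finset.mem_offDiag] at hp
        have h1 := hf _ hp.1
        have h2 := hf _ hp.2.1
        simp only [Nat.dist]
        omega
    _ ≤ B ^ (d * d) := by
        refine Nat.pow_le_pow_right hB ?_
        rw [Finset.offDiag_card]
        exact (Nat.sub_le _ _).trans (Nat.mul_le_mul hd hd)

/-- A small modulus that separates the elements of a small set. -/
theorem exists_modulus {e : Finset ℕ} {L d : ℕ} (he : ∀ x ∈ e, x < 2 ^ L) (hd : e.card ≤ d) :
    ∃ m, 2 ≤ m ∧ m ≤ 2 * (L * (d * d) + 1) ∧ Set.InjOn (· % m) (e : Set ℕ) := by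
  have hpos : 0 < distProd e id := distProd_pos (Set.injOn_id _)
  -- There are at most `d * d` ordered pairs, at distances at most `2 ^ L`; the `+ 1` makes the
  -- bound strict.
  have hle : distProd e id < 2 ^ (L * (d * d) + 1) := by
    calc distProd e id ≤ (2 ^ L) ^ (d * d) :=
          distProd_le (by positivity) (fun x hx => (he x hx).le) hd
      _ = 2 ^ (L * (d * d)) := (pow_mul _ _ _).symm
      _ < _ := Nat.pow_lt_pow_right (by norm_num) (by omega)
  obtain ⟨m, hm2, hm, hnd⟩ := exists_not_dvd_of_lt_two_pow hpos hle
  refine ⟨m, hm2, hm, fun x hx y hy hxy => ?_⟩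
  by_contra hne
  -- A collision modulo `m` makes `m` divide one distance, hence the product.
  refine hnd (dvd_trans ?_ (dist_dvd_distProd id hx hy hne))
  simp only [id, Nat.dist]
  rcases le_total x y with h | h
  · rw [Nat.sub_eq_zero_of_le h, zero_add]
    exact (Nat.modEq_iff_dvd' h).1 hxy
  · rw [Nat.sub_eq_zero_of_le h, add_zero]
    exact (Nat.modEq_iff_dvd' h).1 (Eq.symm hxy)

/-! ### Coding subsets by divisibility. -/

/-- The `i`-th set of the family: `i` encodes numbers `T`, `K`, `m` with `m ≤ K` and
`K * K + m ≤ T`, and `v` belongs to the set if `(v % m + 1) * K + 1` divides `T`. -/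
def InTrace (i v : ℕ) : Prop :=
  ∃ T K m, 0 < m ∧ m ≤ K ∧ K * K + m ≤ T ∧ i = T * T + (K * K + m) ∧ (v % m + 1) * K + 1 ∣ T

/-- The bound `r ≤ a` keeps `a * a + r` below `(a + 1) * (a + 1)`, so `a` is the integer square root
of the value. -/
theorem mul_self_add_inj {a b r s : ℕ} (hr : r ≤ a) (hs : s ≤ b) (h : a * a + r = b * b + s) :
    a = b ∧ r = s := by
  have : a = b := by
    rcases lt_trichotomy a b with h' | h' | h'
    · nlinarith
    · exact h'
    · nlinarith
  subst this
  omega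

/-- The outer square root recovers `T`, the inner one `K`, and `m` is what remains, so the
quantifiers in `InTrace` have only one candidate. -/
theorem inTrace_iff {T K m : ℕ} (hm : 0 < m) (hK : m ≤ K) (hT : K * K + m ≤ T) (v : ℕ) :
    InTrace (T * T + (K * K + m)) v ↔ (v % m + 1) * K + 1 ∣ T := by
  constructor
  · rintro ⟨T', K', m', hm', hK', hT', h, hd⟩
    obtain ⟨rfl, h'⟩ := mul_self_add_inj hT hT' h
    obtain ⟨rfl, rfl⟩ := mul_self_add_inj hK hK' h'
    exact hd
  · intro h
    exact ⟨T, K, m, hm, hK, hT, rfl, h⟩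

/-- If `K` is a multiple of the distance of `x` and `y`, then `(x + 1) * K + 1` and
`(y + 1) * K + 1` are coprime. -/
theorem coprime_of_dist_dvd {x y K : ℕ} (h : Nat.dist x y ∣ K) :
    Nat.Coprime ((x + 1) * K + 1) ((y + 1) * K + 1) := by
  wlog hxy : x ≤ y generalizing x y
  · exact (this (by rwa [Nat.dist_comm]) (by omega)).symm
  refine Nat.coprime_of_dvd fun p hp h1 h2 => ?_
  -- A common prime divides the difference, hence `K`, hence `1`.
  have h3 : p ∣ (y - x) * K := by
    have := Nat.dvd_sub h2 h1
    rwa [Nat.add_sub_add_right, ← Nat.sub_mul, Nat.add_sub_add_right] at this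
  have h4 : p ∣ K := by
    rcases hp.dvd_mul.1 h3 with h4 | h4
    · rw [Nat.dist_eq_sub_of_le hxy] at h
      exact h4.trans h
    · exact h4
  have h5 : p ∣ 1 := (Nat.dvd_add_right (h4.mul_left _)).1 h1
  exact hp.one_lt.ne' (Nat.dvd_one.1 h5)

/-- The exponent in the size bound for the codes of subsets of sets of size `d`. -/
def traceExp (d : ℕ) : ℕ := 2 + 4 * (3 * (d * d + 1) + (d * d + 3) * d)

/-- Gödel's β-function: residues modulo `m` tell the elements of `e` apart, `K` makes the divisors
attached to them pairwise coprime, and `T` collects the divisors of the elements of `s`. Agreement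
with `s` is needed only on `e`, since traces are intersected with a hyperedge. -/
theorem exists_inTrace_of_modulus {e s : Finset ℕ} {d m M : ℕ} (hs : s ⊆ e) (hd : e.card ≤ d)
    (hm : 2 ≤ m) (hmM : m ≤ M) (hinj : Set.InjOn (· % m) (e : Set ℕ)) :
    ∃ i, 0 < i ∧ i * i ≤ M ^ traceExp d ∧ ∀ v ∈ e, InTrace i v ↔ v ∈ s := by
  have hM : 2 ≤ M := hm.trans hmM
  set D := distProd e (· % m) with hD
  have hDpos : 0 < D := distProd_pos hinj
  have hDle : D ≤ M ^ (d * d) :=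
    distProd_le (by omega) (fun x _ => (Nat.mod_lt x (by omega)).le.trans hmM) hd
  -- The factor `D` gives coprimality; the factor `m` gives `m ≤ K`, needed for decoding.
  set K := m * D with hKdef
  have hmK : m ≤ K := Nat.le_mul_of_pos_right _ hDpos
  have hKle : K ≤ M ^ (d * d + 1) := by
    rw [pow_succ, mul_comm]
    exact Nat.mul_le_mul hmM hDle
  set F : ℕ → ℕ := fun v => (v % m + 1) * K + 1 with hF
  have hFle : ∀ v, F v ≤ M ^ (d * d + 3) := by
    intro v
    have h1 : v % m + 1 ≤ M := (Nat.mod_lt v (by omega)).trans_le hmM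
    have h2 : (v % m + 1) * K ≤ M * M ^ (d * d + 1) := Nat.mul_le_mul h1 hKle
    have h3 : 1 ≤ M * M ^ (d * d + 1) := Nat.mul_pos (by omega) (by positivity)
    calc F v ≤ M * M ^ (d * d + 1) + M * M ^ (d * d + 1) := by simp only [hF]; omega
      _ = 2 * (M * M ^ (d * d + 1)) := by ring
      _ ≤ M * (M * M ^ (d * d + 1)) := Nat.mul_le_mul_right _ hM
      _ = _ := by ring
  -- The factor `K ^ 3` is coprime to every `F v` and ensures `K * K + m ≤ T` even for empty `s`.
  set T := K ^ 3 * ∏ x ∈ s, F x with hTdef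
  have hprod : 0 < ∏ x ∈ s, F x := Finset.prod_pos fun x _ => Nat.succ_pos _
  have hT : K * K + m ≤ T := by
    have h1 : K ^ 3 ≤ T := Nat.le_mul_of_pos_right _ hprod
    have h2 : K * K + m ≤ K ^ 3 := by nlinarith [Nat.mul_le_mul (hm.trans hmK) (le_refl (K * K))]
    omega
  have hTle : T ≤ M ^ (3 * (d * d + 1) + (d * d + 3) * d) := by
    rw [pow_add]
    refine Nat.mul_le_mul ?_ ?_
    · rw [mul_comm, pow_mul]
      exact Nat.pow_le_pow_left hKle 3
    · calc ∏ x ∈ s, F x ≤ (M ^ (d * d + 3)) ^ s.card :=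
            Finset.prod_le_pow_card _ _ _ fun x _ => hFle x
        _ ≤ (M ^ (d * d + 3)) ^ d :=
            Nat.pow_le_pow_right (by positivity) ((Finset.card_le_card hs).trans hd)
        _ = _ := (pow_mul _ _ _).symm
  refine ⟨T * T + (K * K + m), by omega, ?_, fun v hv => ?_⟩
  · have hT1 : 1 ≤ T := by omega
    -- This uses `K * K + m ≤ T ≤ T * T` and `2 ≤ M`; squaring explains the shape `2 + 4 * _` of
    -- `traceExp`.
    have h1 : T * T + (K * K + m) ≤ M * (T * T) := by nlinarith
    calc _ ≤ (M * (T * T)) * (M * (T * T)) := Nat.mul_le_mul h1 h1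
      _ = M ^ 2 * T ^ 4 := by ring
      _ ≤ M ^ 2 * (M ^ (3 * (d * d + 1) + (d * d + 3) * d)) ^ 4 :=
          Nat.mul_le_mul_left _ (Nat.pow_le_pow_left hTle 4)
      _ = M ^ traceExp d := by rw [← pow_mul, ← pow_add, traceExp, mul_comm 4]
  · rw [inTrace_iff (by omega) hmK hT]
    constructor
    · intro hdvd
      by_contra hvs
      have hcop : Nat.Coprime (F v) T := by
        refine Nat.Coprime.mul_right ?_ ?_
        · refine Nat.Coprime.pow_right 3 ?_
          simp [hF]
        · refine Nat.Coprime.prod_right fun x hx => coprime_of_dist_dvd ?_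
          exact (dist_dvd_distProd (· % m) hv (hs hx) (fun h => hvs (h ▸ hx))).trans
            (Dvd.intro_left m rfl)
      have h1 : F v = 1 := Nat.dvd_one.1 (hcop ▸ Nat.dvd_gcd (dvd_refl (F v)) hdvd)
      simp only [hF, Nat.add_eq_right, mul_eq_zero] at h1
      omega
    · intro hvs
      exact (Finset.dvd_prod_of_mem F hvs).mul_left _

/-! ### Size of the codes. -/

/-- A bound on the logarithm of the size of the structures in which not all subsets of sets of size
`d` have a code. -/
def traceLog (d : ℕ) : ℕ := 64 * traceExp d * traceExp d * (d * d + 1)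

/-- A fixed power of a linear function of `L` is eventually below `2 ^ L`. With `E = traceExp d`, `D
= d * d + 1` and `q = L / (4 * E)`, the constant 64 lets the exponents `16 * E * E * D` and `q * E`
each take at most a quarter of `L`. -/
theorem modulus_pow_le {d L : ℕ} (hL : traceLog d ≤ L) :
    (2 * ((L + 1) * (d * d) + 1)) ^ traceExp d ≤ 2 ^ L := by
  set E := traceExp d with hE
  have hEpos : 0 < E := by simp [hE, traceExp]
  set D := d * d + 1 with hD
  have hL' : 64 * E * E * D ≤ L := hL
  have hEE : 1 ≤ E * E * D := Nat.mul_pos (Nat.mul_pos hEpos hEpos) (by omega)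
  set q := L / (4 * E) with hq
  have h1 : q < 2 ^ q := Nat.lt_two_pow_self
  have h2 : L < 4 * E * (q + 1) := by
    have := Nat.lt_mul_div_succ L (show 0 < 4 * E by omega)
    simpa [hq] using this
  have h3 : L + 1 ≤ 4 * E * 2 ^ q := by
    have : 4 * E * (q + 1) ≤ 4 * E * 2 ^ q := Nat.mul_le_mul_left _ h1
    omega
  have h4 : 2 * ((L + 1) * (d * d) + 1) ≤ 2 ^ (16 * E * D) * 2 ^ q := by
    calc 2 * ((L + 1) * (d * d) + 1) ≤ 2 * ((L + 1) * D) := by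
          simp only [hD]; nlinarith
      _ ≤ 2 * (4 * E * 2 ^ q * D) := by gcongr
      _ = (8 * E * D) * 2 ^ q := by ring
      _ ≤ 2 ^ (16 * E * D) * 2 ^ q := by
          refine Nat.mul_le_mul_right _ (le_trans ?_ Nat.lt_two_pow_self.le)
          nlinarith
  calc _ ≤ (2 ^ (16 * E * D) * 2 ^ q) ^ E := Nat.pow_le_pow_left h4 _
    _ = 2 ^ ((16 * E * D + q) * E) := by rw [← pow_add, ← pow_mul]
    _ ≤ 2 ^ L := by
        refine Nat.pow_le_pow_right (by norm_num) ?_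
        have h5 : 4 * E * q ≤ L := Nat.mul_div_le L (4 * E)
        nlinarith

/-- Above this size, all subsets of sets of size at most `d` have a code. -/
def traceBound (d : ℕ) : ℕ := 2 ^ traceLog d

/-- Elements up to `n` have `log₂ n + 1` bits, so the modulus is logarithmic in `n` for fixed `d`.
Positivity of `i` matters because second digit `0` is reserved for the original sets. -/
theorem exists_inTrace {e s : Finset ℕ} {d n : ℕ} (hn : traceBound d ≤ n) (hs : s ⊆ e)
    (hd : e.card ≤ d) (he : ∀ x ∈ e, x ≤ n) :
    ∃ i, 0 < i ∧ i * i ≤ n ∧ ∀ v ∈ e, InTrace i v ↔ v ∈ s := by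
  have hn0 : n ≠ 0 := by
    have : 0 < traceBound d := by unfold traceBound; positivity
    omega
  have hL : traceLog d ≤ Nat.log 2 n := Nat.le_log_of_pow_le (by norm_num) hn
  obtain ⟨m, hm2, hm, hinj⟩ := exists_modulus (L := Nat.log 2 n + 1)
    (fun x hx => (he x hx).trans_lt (Nat.lt_pow_succ_log_self (by norm_num) n)) hd
  obtain ⟨i, hi, hle, h⟩ := exists_inTrace_of_modulus hs hd hm2 hm hinj
  exact ⟨i, hi, (hle.trans (modulus_pow_le hL)).trans (Nat.pow_log_le_self 2 hn0), h⟩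

open FirstOrder FirstOrder.Language

/-! ## Positions of the elements of an arithmetic structure -/

namespace Struc

variable {σ : Vocabulary} (A : Struc σ)

/-- The position of the maximal element of `A`. -/
noncomputable def top : ℕ := A.isArithmetic.choose

/-- The bijection of the universe of `A` with an initial segment of the natural numbers. -/
noncomputable def posEquiv : A.carrier ≃ Fin (A.top + 1) := A.isArithmetic.choose_spec.choose

/-- The position of an element of `A`. -/
noncomputable def val (x : A.carrier) : ℕ := A.posEquiv x

/-- The element of `A` at position `a`. -/
noncomputable def elem (a : ℕ) (h : a ≤ A.top) : A.carrier :=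
  A.posEquiv.symm ⟨a, Nat.lt_succ_of_le h⟩

@[simp] theorem val_elem (a : ℕ) (h : a ≤ A.top) : A.val (A.elem a h) = a := by
  simp [val, elem]

theorem val_le (x : A.carrier) : A.val x ≤ A.top := Nat.le_of_lt_succ (A.posEquiv x).2

theorem val_injective : Function.Injective A.val :=
  Fin.val_injective.comp A.posEquiv.injective

theorem val_inj {x y : A.carrier} : A.val x = A.val y ↔ x = y := A.val_injective.eq_iff

theorem relMap_lt (x y : A.carrier) :
    Structure.RelMap (L := arithLang σ) ArithRel.lt ![x, y] ↔ A.val x < A.val y :=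
  A.isArithmetic.choose_spec.choose_spec.1 x y

theorem relMap_add (x y z : A.carrier) :
    Structure.RelMap (L := arithLang σ) ArithRel.add ![x, y, z] ↔ A.val x + A.val y = A.val z :=
  A.isArithmetic.choose_spec.choose_spec.2.1 x y z

theorem relMap_mult (x y z : A.carrier) :
    Structure.RelMap (L := arithLang σ) ArithRel.mult ![x, y, z] ↔ A.val x * A.val y = A.val z :=
  A.isArithmetic.choose_spec.choose_spec.2.2.1 x y z

theorem val_zero :
    A.val (Structure.funMap (L := arithLang σ) ArithFunc.zero ![]) = 0 :=
  A.isArithmetic.choose_spec.choose_spec.2.2.2.1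

theorem val_succ (x : A.carrier) :
    A.val (Structure.funMap (L := arithLang σ) ArithFunc.succ ![x]) = min (A.val x + 1) A.top :=
  A.isArithmetic.choose_spec.choose_spec.2.2.2.2 x

instance : Finite A.carrier := Finite.of_equiv _ A.posEquiv.symm

end Struc

/-! ## Terms and atomic formulas -/

section Atoms

variable {σ : Vocabulary} {α : Type} {n : ℕ}

/-- The term `0`. -/
def zeroT : (arithLang σ).Term α := Term.func (L := arithLang σ) ArithFunc.zero ![]

/-- The successor of a term. -/
def succT (t : (arithLang σ).Term α) : (arithLang σ).Term α :=
  Term.func (L := arithLang σ) ArithFunc.succ ![t]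

/-- The formula `t < u`. -/
def ltF (t u : (arithLang σ).Term (α ⊕ Fin n)) : (arithLang σ).BoundedFormula α n :=
  BoundedFormula.rel (L := arithLang σ) ArithRel.lt ![t, u]

/-- The formula `t ≤ u`. -/
def leF (t u : (arithLang σ).Term (α ⊕ Fin n)) : (arithLang σ).BoundedFormula α n := ∼(ltF u t)

/-- The formula `t + u = w`. -/
def addF (t u w : (arithLang σ).Term (α ⊕ Fin n)) : (arithLang σ).BoundedFormula α n :=
  BoundedFormula.rel (L := arithLang σ) ArithRel.add ![t, u, w]

/-- The formula `t * u = w`. -/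
def multF (t u w : (arithLang σ).Term (α ⊕ Fin n)) : (arithLang σ).BoundedFormula α n :=
  BoundedFormula.rel (L := arithLang σ) ArithRel.mult ![t, u, w]

/-- The formula `t + 1 = u`. -/
def nextF (t u : (arithLang σ).Term (α ⊕ Fin n)) : (arithLang σ).BoundedFormula α n :=
  Term.bdEqual (succT t) u ⊓ ltF t u

variable {A : Struc σ}

@[simp] theorem val_realize_zeroT (v : α → A.carrier) : A.val ((zeroT (σ := σ)).realize v) = 0 := by
  rw [← A.val_zero, zeroT, Term.realize]
  congr 2
  exact Subsingleton.elim _ _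

@[simp] theorem val_realize_succT (t : (arithLang σ).Term α) (v : α → A.carrier) :
    A.val ((succT t).realize v) = min (A.val (t.realize v) + 1) A.top := by
  rw [← A.val_succ, succT, Term.realize]
  congr 2
  funext i
  fin_cases i
  rfl

variable (t u w : (arithLang σ).Term (α ⊕ Fin n)) (v : α → A.carrier) (xs : Fin n → A.carrier)

theorem realize_eqF : (Term.bdEqual t u).Realize v xs ↔
    A.val (t.realize (Sum.elim v xs)) = A.val (u.realize (Sum.elim v xs)) := by
  rw [BoundedFormula.realize_bdEqual, A.val_inj]

@[simp] theorem realize_ltF : (ltF t u).Realize v xs ↔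
    A.val (t.realize (Sum.elim v xs)) < A.val (u.realize (Sum.elim v xs)) := by
  rw [← A.relMap_lt, ltF, BoundedFormula.Realize]
  congr! 1
  funext i
  fin_cases i <;> rfl

@[simp] theorem realize_leF : (leF t u).Realize v xs ↔
    A.val (t.realize (Sum.elim v xs)) ≤ A.val (u.realize (Sum.elim v xs)) := by
  simp [leF]

@[simp] theorem realize_addF : (addF t u w).Realize v xs ↔
    A.val (t.realize (Sum.elim v xs)) + A.val (u.realize (Sum.elim v xs)) =
      A.val (w.realize (Sum.elim v xs)) := by
  rw [← A.relMap_add, addF, BoundedFormula.Realize]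
  congr! 1
  funext i
  fin_cases i <;> rfl

@[simp] theorem realize_multF : (multF t u w).Realize v xs ↔
    A.val (t.realize (Sum.elim v xs)) * A.val (u.realize (Sum.elim v xs)) =
      A.val (w.realize (Sum.elim v xs)) := by
  rw [← A.relMap_mult, multF, BoundedFormula.Realize]
  congr! 1
  funext i
  fin_cases i <;> rfl

-- Since `succ` fixes the maximum, the strict inequality in `nextF` is what excludes `t = u` there.
@[simp] theorem realize_nextF : (nextF t u).Realize v xs ↔
    A.val (t.realize (Sum.elim v xs)) + 1 = A.val (u.realize (Sum.elim v xs)) := by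
  have := A.val_le (u.realize (Sum.elim v xs))
  rw [nextF, BoundedFormula.realize_inf, realize_eqF, realize_ltF, val_realize_succT]
  omega

end Atoms

/-! ## Formulas for the arithmetic of pairs -/

section PairFormulas

variable {σ : Vocabulary} {α : Type}

/-- The term consisting of a free variable. -/
abbrev freeVar {n : ℕ} (a : α) : (arithLang σ).Term (α ⊕ Fin n) := Term.var (Sum.inl a)

/-- The value of the bound variable is the square root of the maximal element, rounded down. -/
def sqrtTopF : (arithLang σ).BoundedFormula α 1 :=
  ∃' (multF (&0) (&0) (&1)) ⊓ ∀' (ltF (&0) (&1) ⟹ ∀' ∼(multF (&1) (&1) (&2)))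

/-- A product exists in `A` exactly when it is at most `A.top`, so having a square means `x * x ≤
A.top`. -/
theorem realize_sqrtTopF {A : Struc σ} (v : α → A.carrier) (xs : Fin 1 → A.carrier) :
    (sqrtTopF (σ := σ)).Realize v xs ↔ A.val (xs 0) = A.top.sqrt := by
  simp [sqrtTopF, Fin.snoc]
  constructor
  · rintro ⟨⟨z, hz⟩, h⟩
    have h1 := A.val_le z
    refine Nat.eq_sqrt.2 ⟨by omega, ?_⟩
    by_contra! hc
    have h2 : A.val (xs 0) + 1 ≤ A.top := by nlinarith
    refine h (A.elem _ h2) ?_ (A.elem _ hc) ?_ <;> simp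
  · intro h
    have h1 := Nat.sqrt_le A.top
    refine ⟨⟨A.elem _ h1, by simp [h]⟩, fun x hx y hy => ?_⟩
    have h2 := A.val_le y
    have h3 : A.val x ≤ A.top.sqrt := Nat.le_sqrt.2 (by omega)
    omega

/-- Pairs are the digits of a number; the second digit is smaller than the base, the square root of
the maximal element plus one. -/
def pairUnivF : (arithLang σ).Formula (Fin 2) :=
  ∃' (multF (freeVar 1) (freeVar 1) (&0))

theorem realize_pairUnivF {A : Struc σ} (v : Fin 2 → A.carrier) :
    (pairUnivF (σ := σ)).Realize v ↔ A.val (v 1) ≤ A.top.sqrt := by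
  simp [pairUnivF, Formula.Realize, Fin.snoc]
  rw [Nat.le_sqrt]
  constructor
  · rintro ⟨z, hz⟩
    have := A.val_le z
    omega
  · intro h
    exact ⟨A.elem _ h, by simp⟩

/-- The lexicographic order of pairs. -/
def pairLtF : (arithLang σ).Formula (Fin 2 × Fin 2) :=
  ltF (freeVar (0, 0)) (freeVar (1, 0)) ⊔
    (Term.bdEqual (freeVar (0, 0)) (freeVar (1, 0)) ⊓ ltF (freeVar (0, 1)) (freeVar (1, 1)))

/-- The addition of pairs; the second case is the one with a carry. -/
def pairAddF : (arithLang σ).Formula (Fin 3 × Fin 2) :=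
  (addF (freeVar (0, 1)) (freeVar (1, 1)) (freeVar (2, 1)) ⊓
    addF (freeVar (0, 0)) (freeVar (1, 0)) (freeVar (2, 0))) ⊔
  ∃' (sqrtTopF ⊓ ∃' ∃' ∃'
    (addF (freeVar (0, 1)) (&1) (&0) ⊓ addF (&1) (freeVar (2, 1)) (&2) ⊓
      nextF (&2) (freeVar (1, 1)) ⊓
      addF (freeVar (0, 0)) (freeVar (1, 0)) (&3) ⊓ nextF (&3) (freeVar (2, 0))))

/-- The multiplication of pairs. -/
def pairMultF : (arithLang σ).Formula (Fin 3 × Fin 2) :=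
  ∃' (sqrtTopF ⊓ ∃' ∃' ∃' ∃' ∃' ∃' ∃' ∃' ∃' ∃' ∃'
    (multF (freeVar (0, 0)) (freeVar (1, 0)) (&1) ⊓ multF (&1) (&0) (&2) ⊓
      multF (freeVar (0, 0)) (freeVar (1, 1)) (&3) ⊓
      multF (freeVar (0, 1)) (freeVar (1, 0)) (&4) ⊓
      multF (freeVar (0, 1)) (freeVar (1, 1)) (&5) ⊓
      multF (&6) (&0) (&7) ⊓ addF (&7) (&6) (&8) ⊓ addF (&8) (freeVar (2, 1)) (&5) ⊓
      addF (&1) (&2) (&9) ⊓ addF (&9) (&3) (&10) ⊓ addF (&10) (&4) (&11) ⊓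
      addF (&11) (&6) (freeVar (2, 0))))

/-- The pair `(0, 0)`. -/
def pairZeroF : (arithLang σ).Formula (Fin 1 × Fin 2) :=
  Term.bdEqual (freeVar (0, 0)) zeroT ⊓ Term.bdEqual (freeVar (0, 1)) zeroT

/-- The successor of pairs. The cases are: no carry, carry, the maximal pair. -/
def pairSuccF : (arithLang σ).Formula (Fin 2 × Fin 2) :=
  (Term.bdEqual (freeVar (0, 0)) (freeVar (1, 0)) ⊓ nextF (freeVar (0, 1)) (freeVar (1, 1))) ⊔
  ∃' (sqrtTopF ⊓ Term.bdEqual (freeVar (0, 1)) (&0) ⊓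
    ((nextF (freeVar (0, 0)) (freeVar (1, 0)) ⊓ Term.bdEqual (freeVar (1, 1)) zeroT) ⊔
      (Term.bdEqual (succT (freeVar (0, 0))) (freeVar (0, 0)) ⊓
        Term.bdEqual (freeVar (0, 0)) (freeVar (1, 0)) ⊓
        Term.bdEqual (freeVar (1, 1)) (&0))))

variable {A : Struc σ}

theorem realize_pairLtF (v : Fin 2 × Fin 2 → A.carrier) : (pairLtF (σ := σ)).Realize v ↔
    A.val (v (0, 0)) < A.val (v (1, 0)) ∨
      (A.val (v (0, 0)) = A.val (v (1, 0)) ∧ A.val (v (0, 1)) < A.val (v (1, 1))) := by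
  simp [pairLtF, Formula.Realize, realize_eqF, -BoundedFormula.realize_bdEqual]

/-- Both `√n + 1` and the sum of the second digits `b`, `b'` can exceed the maximum. A carry with
result digit `c` is therefore tested through the complement `t` of `b`: `b + t = √n` and `t + c + 1
= b'`. -/
theorem realize_pairAddF (v : Fin 3 × Fin 2 → A.carrier) (h0 : A.val (v (0, 1)) ≤ A.top.sqrt)
    (h1 : A.val (v (1, 1)) ≤ A.top.sqrt) : (pairAddF (σ := σ)).Realize v ↔
    (A.val (v (0, 1)) + A.val (v (1, 1)) = A.val (v (2, 1)) ∧
      A.val (v (0, 0)) + A.val (v (1, 0)) = A.val (v (2, 0))) ∨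
    (A.val (v (0, 1)) + A.val (v (1, 1)) = A.top.sqrt + 1 + A.val (v (2, 1)) ∧
      A.val (v (0, 0)) + A.val (v (1, 0)) + 1 = A.val (v (2, 0))) := by
  simp [pairAddF, Formula.Realize, realize_sqrtTopF, Fin.snoc]
  refine or_congr_right ⟨?_, ?_⟩
  · rintro ⟨l, hl, t, u, w, h⟩
    omega
  · rintro ⟨h2, h3⟩
    have h4 := Nat.sqrt_le_self A.top
    have h5 := A.val_le (v (2, 0))
    refine ⟨A.elem _ h4, by simp, A.elem (A.top.sqrt - A.val (v (0, 1))) (by omega),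
      A.elem (A.val (v (1, 1)) - 1) (by omega), A.elem (A.val (v (2, 0)) - 1) (by omega), ?_⟩
    simp
    omega

/-- Here `q` is the carry from the product of the second digits, which is at most `√n * √n ≤ n`.
Every other intermediate value is bounded by that product or by the first digit of the result.
Multiplying by `√n + 1` is done as multiplying by `√n` and adding, since `√n + 1` may be missing
from the universe. -/
theorem realize_pairMultF (v : Fin 3 × Fin 2 → A.carrier) (h0 : A.val (v (0, 1)) ≤ A.top.sqrt)
    (h1 : A.val (v (1, 1)) ≤ A.top.sqrt) : (pairMultF (σ := σ)).Realize v ↔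
    ∃ q, A.val (v (0, 1)) * A.val (v (1, 1)) = q * (A.top.sqrt + 1) + A.val (v (2, 1)) ∧
      A.val (v (0, 0)) * A.val (v (1, 0)) * (A.top.sqrt + 1) +
        A.val (v (0, 0)) * A.val (v (1, 1)) + A.val (v (0, 1)) * A.val (v (1, 0)) + q =
      A.val (v (2, 0)) := by
  simp [pairMultF, Formula.Realize, realize_sqrtTopF, Fin.snoc]
  constructor
  · rintro ⟨l, hl, t1, t2, t3, t4, t5, q, t7, t8, t9, t10, t11, h⟩
    simp only [hl, and_assoc] at h
    have e1 := h.1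
    rw [← e1] at h
    refine ⟨A.val q, ?_, ?_⟩
    · rw [mul_add]
      omega
    · rw [mul_add]
      omega
  · rintro ⟨q, h2, h3⟩
    have h4 := Nat.sqrt_le_self A.top
    have h5 := A.val_le (v (2, 0))
    have h6 : A.val (v (0, 1)) * A.val (v (1, 1)) ≤ A.top :=
      (Nat.mul_le_mul h0 h1).trans (Nat.sqrt_le A.top)
    rw [mul_add] at h2 h3
    refine ⟨A.elem _ h4, by simp,
      A.elem (A.val (v (0, 0)) * A.val (v (1, 0))) (by omega),
      A.elem (A.val (v (0, 0)) * A.val (v (1, 0)) * A.top.sqrt) (by omega),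
      A.elem (A.val (v (0, 0)) * A.val (v (1, 1))) (by omega),
      A.elem (A.val (v (0, 1)) * A.val (v (1, 0))) (by omega),
      A.elem (A.val (v (0, 1)) * A.val (v (1, 1))) (by omega),
      A.elem q (by omega), A.elem (q * A.top.sqrt) (by omega),
      A.elem (q * A.top.sqrt + q) (by omega),
      A.elem (A.val (v (0, 0)) * A.val (v (1, 0)) +
        A.val (v (0, 0)) * A.val (v (1, 0)) * A.top.sqrt) (by omega),
      A.elem (A.val (v (0, 0)) * A.val (v (1, 0)) +
        A.val (v (0, 0)) * A.val (v (1, 0)) * A.top.sqrt +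
          A.val (v (0, 0)) * A.val (v (1, 1))) (by omega),
      A.elem (A.val (v (0, 0)) * A.val (v (1, 0)) +
        A.val (v (0, 0)) * A.val (v (1, 0)) * A.top.sqrt +
          A.val (v (0, 0)) * A.val (v (1, 1)) + A.val (v (0, 1)) * A.val (v (1, 0)))
        (by omega), ?_⟩
    simp
    omega

theorem realize_pairZeroF (v : Fin 1 × Fin 2 → A.carrier) : (pairZeroF (σ := σ)).Realize v ↔
    A.val (v (0, 0)) = 0 ∧ A.val (v (0, 1)) = 0 := by
  simp [pairZeroF, Formula.Realize, realize_eqF, -BoundedFormula.realize_bdEqual]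

/-- The equation `succT a = a` singles out the maximal first digit. -/
theorem realize_pairSuccF (v : Fin 2 × Fin 2 → A.carrier) : (pairSuccF (σ := σ)).Realize v ↔
    (A.val (v (0, 0)) = A.val (v (1, 0)) ∧ A.val (v (0, 1)) + 1 = A.val (v (1, 1))) ∨
    (A.val (v (0, 1)) = A.top.sqrt ∧
      ((A.val (v (0, 0)) + 1 = A.val (v (1, 0)) ∧ A.val (v (1, 1)) = 0) ∨
        (A.val (v (0, 0)) = A.top ∧ A.val (v (0, 0)) = A.val (v (1, 0)) ∧
          A.val (v (1, 1)) = A.top.sqrt))) := by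
  have h0 := A.val_le (v (0, 0))
  have h1 := A.val_le (v (1, 0))
  simp [pairSuccF, Formula.Realize, realize_eqF, -BoundedFormula.realize_bdEqual,
    realize_sqrtTopF, Fin.snoc]
  refine or_congr_right ⟨?_, ?_⟩
  · rintro ⟨l, hl, h⟩
    omega
  · intro h
    refine ⟨A.elem _ (Nat.sqrt_le_self A.top), ?_⟩
    simp
    omega

end PairFormulas

/-! ## Queries whose universe consists of pairs -/

section PairQuery

variable {σ σ' : Vocabulary}
  (φ : (i : Fin σ'.numRel) → (arithLang σ).Formula (Fin (σ'.arity i) × Fin 2))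

/-- The formulas for the relation symbols of the query `pairQuery`. -/
def pairRelF : {n : ℕ} → ArithRel σ' n → (arithLang σ).Formula (Fin n × Fin 2)
  | _, .lt => pairLtF
  | _, .add => pairAddF
  | _, .mult => pairMultF
  | _, .sym i => φ i

/-- The formulas for the function symbols of the query `pairQuery`. -/
def pairFuncF : {n : ℕ} → ArithFunc n → (arithLang σ).Formula (Fin (n + 1) × Fin 2)
  | _, .zero => pairZeroF
  | _, .succ => pairSuccF

/-- The formulas of the query whose universe consists of pairs, with arbitrary formulas for the
relation symbols. -/
def pairFormulas : QueryFormulas σ σ' where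
  width := 2
  univ := pairUnivF
  rel := pairRelF φ
  func := pairFuncF

/-! ### Two-digit positions in base `√n + 1`. -/

namespace pairFormulas

variable {φ} {A : Struc σ}

/-- The first digit. -/
noncomputable def fst (x : (pairFormulas φ).Universe A) : ℕ := A.val (x.1 (0 : Fin 2))

/-- The second digit. -/
noncomputable def snd (x : (pairFormulas φ).Universe A) : ℕ := A.val (x.1 (1 : Fin 2))

theorem fst_le (x : (pairFormulas φ).Universe A) : fst x ≤ A.top := A.val_le _

theorem snd_le (x : (pairFormulas φ).Universe A) : snd x ≤ A.top.sqrt :=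
  (realize_pairUnivF x.1).1 x.2

theorem ext_digits {x y : (pairFormulas φ).Universe A} (h0 : fst x = fst y) (h1 : snd x = snd y) :
    x = y := by
  apply Subtype.ext
  funext (i : Fin 2)
  fin_cases i
  · exact A.val_injective h0
  · exact A.val_injective h1

theorem exists_digits {a b : ℕ} (ha : a ≤ A.top) (hb : b ≤ A.top.sqrt) :
    ∃ x : (pairFormulas φ).Universe A, fst x = a ∧ snd x = b :=
  ⟨⟨![A.elem a ha, A.elem b (hb.trans (Nat.sqrt_le_self _))],
    (realize_pairUnivF _).2 (by simpa using hb)⟩, by simp [fst], by simp [snd]⟩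

/-- The number represented by a pair of digits. -/
noncomputable def pos (x : (pairFormulas φ).Universe A) : ℕ :=
  fst x * (A.top.sqrt + 1) + snd x

variable (A) in
/-- The maximal number represented by a pair of digits. -/
noncomputable def maxPos : ℕ := A.top * (A.top.sqrt + 1) + A.top.sqrt

theorem pos_le (x : (pairFormulas φ).Universe A) : pos x ≤ maxPos A :=
  Nat.add_le_add (Nat.mul_le_mul_right _ (fst_le x)) (snd_le x)

theorem digits_unique {s p q r t : ℕ} (hr : r ≤ s) (ht : t ≤ s) :
    p * (s + 1) + r = q * (s + 1) + t ↔ p = q ∧ r = t := by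
  refine ⟨fun h => ?_, by rintro ⟨rfl, rfl⟩; rfl⟩
  have h1 := congrArg (· / (s + 1)) h
  simp only [Nat.add_comm _ r, Nat.add_comm _ t] at h1
  rw [Nat.add_mul_div_right _ _ (by omega), Nat.add_mul_div_right _ _ (by omega),
    Nat.div_eq_of_lt (by omega), Nat.div_eq_of_lt (by omega)] at h1
  have h2 : p = q := by omega
  subst h2
  omega

theorem pos_injective : Function.Injective (pos : (pairFormulas φ).Universe A → ℕ) := by
  intro x y h
  obtain ⟨h0, h1⟩ := (digits_unique (snd_le x) (snd_le y)).1 h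
  exact ext_digits h0 h1

theorem exists_pos {a : ℕ} (ha : a ≤ maxPos A) :
    ∃ x : (pairFormulas φ).Universe A, pos x = a := by
  have h0 : a / (A.top.sqrt + 1) ≤ A.top := by
    rw [← Nat.lt_succ_iff, Nat.div_lt_iff_lt_mul (by omega), Nat.succ_mul]
    unfold maxPos at ha
    omega
  have h1 : a % (A.top.sqrt + 1) ≤ A.top.sqrt := Nat.le_of_lt_succ (Nat.mod_lt _ (by omega))
  obtain ⟨x, hx0, hx1⟩ := exists_digits (φ := φ) h0 h1
  refine ⟨x, ?_⟩
  rw [pos, hx0, hx1, mul_comm]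
  exact Nat.div_add_mod _ _

theorem rel_lt (x y : (pairFormulas φ).Universe A) :
    (pairFormulas φ).Rel A ArithRel.lt ![x, y] ↔ pos x < pos y := by
  refine (realize_pairLtF _).trans ?_
  change (fst x < fst y ∨ fst x = fst y ∧ snd x < snd y) ↔ _
  have hx := snd_le x
  have hy := snd_le y
  unfold pos
  constructor
  · rintro (h | ⟨h, h'⟩)
    · nlinarith
    · rw [h]
      omega
  · intro h
    rcases lt_trichotomy (fst x) (fst y) with h' | h' | h'
    · exact Or.inl h'
    · rw [h'] at h
      exact Or.inr ⟨h', by omega⟩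
    · nlinarith

theorem rel_add (x y z : (pairFormulas φ).Universe A) :
    (pairFormulas φ).Rel A ArithRel.add ![x, y, z] ↔ pos x + pos y = pos z := by
  refine (realize_pairAddF (fun p : Fin 3 × Fin 2 => (![x, y, z] p.1).1 p.2) (snd_le x) (snd_le y)).trans ?_
  change (snd x + snd y = snd z ∧ fst x + fst y = fst z ∨
    snd x + snd y = A.top.sqrt + 1 + snd z ∧ fst x + fst y + 1 = fst z) ↔ _
  have hx := snd_le x
  have hy := snd_le y
  have hz := snd_le z
  unfold pos
  rcases Nat.lt_or_ge A.top.sqrt (snd x + snd y) with h | h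
  · obtain ⟨r, hr⟩ := Nat.exists_eq_add_of_lt h
    have h1 : fst x * (A.top.sqrt + 1) + snd x + (fst y * (A.top.sqrt + 1) + snd y) =
        (fst x + fst y + 1) * (A.top.sqrt + 1) + r := by
      linear_combination hr
    rw [h1, digits_unique (by omega) hz]
    omega
  · have h1 : fst x * (A.top.sqrt + 1) + snd x + (fst y * (A.top.sqrt + 1) + snd y) =
        (fst x + fst y) * (A.top.sqrt + 1) + (snd x + snd y) := by
      ring
    rw [h1, digits_unique h hz]
    omega

theorem rel_mult (x y z : (pairFormulas φ).Universe A) :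
    (pairFormulas φ).Rel A ArithRel.mult ![x, y, z] ↔ pos x * pos y = pos z := by
  refine (realize_pairMultF (fun p : Fin 3 × Fin 2 => (![x, y, z] p.1).1 p.2) (snd_le x) (snd_le y)).trans ?_
  change (∃ q, snd x * snd y = q * (A.top.sqrt + 1) + snd z ∧
    fst x * fst y * (A.top.sqrt + 1) + fst x * snd y + snd x * fst y + q = fst z) ↔ _
  have hz := snd_le z
  -- Long multiplication with carry `q`; for `r ≤ √n`, uniqueness of digits reads off both digits of
  -- the product.
  have key : ∀ q r, snd x * snd y = q * (A.top.sqrt + 1) + r → pos x * pos y =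
      (fst x * fst y * (A.top.sqrt + 1) + fst x * snd y + snd x * fst y + q) *
        (A.top.sqrt + 1) + r := by
    intro q r h
    unfold pos
    linear_combination h
  constructor
  · rintro ⟨q, h1, h2⟩
    rw [key _ _ h1, h2, pos]
  · intro h
    have h1 : snd x * snd y = snd x * snd y / (A.top.sqrt + 1) * (A.top.sqrt + 1) +
        snd x * snd y % (A.top.sqrt + 1) := (Nat.div_add_mod' _ _).symm
    rw [key _ _ h1, pos,
      digits_unique (Nat.le_of_lt_succ (Nat.mod_lt _ (by omega))) hz] at h
    exact ⟨_, h.2 ▸ h1, h.1⟩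

theorem graph_zero (xs : Fin 0 → (pairFormulas φ).Universe A) (y : (pairFormulas φ).Universe A) :
    (pairFormulas φ).Graph A ArithFunc.zero xs y ↔ pos y = 0 := by
  refine (realize_pairZeroF _).trans ?_
  change fst y = 0 ∧ snd y = 0 ↔ _
  simp [pos]

theorem graph_succ (xs : Fin 1 → (pairFormulas φ).Universe A) (y : (pairFormulas φ).Universe A) :
    (pairFormulas φ).Graph A ArithFunc.succ xs y ↔ pos y = min (pos (xs 0) + 1) (maxPos A) := by
  refine (realize_pairSuccF _).trans ?_
  generalize hx : xs 0 = x
  change (fst (xs 0) = fst y ∧ snd (xs 0) + 1 = snd y ∨ snd (xs 0) = A.top.sqrt ∧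
    (fst (xs 0) + 1 = fst y ∧ snd y = 0 ∨
      fst (xs 0) = A.top ∧ fst (xs 0) = fst y ∧ snd y = A.top.sqrt)) ↔ _
  rw [hx]
  have hx0 := fst_le x
  have hx1 := snd_le x
  have hy0 := fst_le y
  have hy1 := snd_le y
  rcases Nat.lt_or_ge (snd x) A.top.sqrt with h | h
  · have h1 : min (pos x + 1) (maxPos A) = fst x * (A.top.sqrt + 1) + (snd x + 1) := by
      have := Nat.mul_le_mul_right (A.top.sqrt + 1) hx0
      unfold pos maxPos
      omega
    rw [h1, pos, digits_unique hy1 (by omega)]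
    omega
  · have h2 : snd x = A.top.sqrt := le_antisymm hx1 h
    rcases Nat.lt_or_ge (fst x) A.top with h' | h'
    · have h1 : min (pos x + 1) (maxPos A) = (fst x + 1) * (A.top.sqrt + 1) + 0 := by
        have := Nat.mul_le_mul_right (A.top.sqrt + 1) (Nat.succ_le_of_lt h')
        rw [Nat.succ_mul] at this
        unfold pos maxPos
        rw [Nat.add_mul, h2]
        omega
      rw [h1, pos, digits_unique hy1 (by omega)]
      omega
    · have h3 : fst x = A.top := le_antisymm hx0 h'
      have h1 : min (pos x + 1) (maxPos A) = A.top * (A.top.sqrt + 1) + A.top.sqrt := by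
        unfold pos maxPos
        rw [h2, h3]
        omega
      rw [h1, pos, digits_unique hy1 (by omega)]
      omega

/-- The graphs of `zero` and `succ` both have the form `pos y = a`, so totality and uniqueness come
from the bijectivity of `pos` onto the numbers up to `maxPos A`. -/
theorem existsUnique_pos {p : (pairFormulas φ).Universe A → Prop} {a : ℕ} (ha : a ≤ maxPos A)
    (h : ∀ y, p y ↔ pos y = a) : ∃! y, p y := by
  obtain ⟨y, hy⟩ := exists_pos (φ := φ) ha
  exact ⟨y, (h y).2 hy, fun z hz => pos_injective (((h z).1 hz).trans hy.symm)⟩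

variable (φ A) in
theorem isFunctional : (pairFormulas φ).IsFunctional A
  | _, .zero, xs => existsUnique_pos (Nat.zero_le _) (graph_zero xs)
  | _, .succ, xs => existsUnique_pos (min_le_right _ _) (graph_succ xs)

variable (φ A) in
theorem isArithmetic :
    @IsArithmetic σ' ((pairFormulas φ).Universe A) ((pairFormulas φ).image A (isFunctional φ A)) := by
  refine ⟨maxPos A, Equiv.ofBijective (fun x => ⟨pos x, Nat.lt_succ_of_le (pos_le x)⟩)
    ⟨fun x y h => pos_injective (congrArg Fin.val h), fun a => ?_⟩, ?_, ?_, ?_, ?_, ?_⟩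
  · obtain ⟨x, hx⟩ := exists_pos (φ := φ) (Nat.le_of_lt_succ a.2)
    exact ⟨x, Fin.ext hx⟩
  · exact rel_lt
  · exact rel_add
  · exact rel_mult
  · exact (graph_zero _ _).1 (isFunctional φ A _ ArithFunc.zero ![]).choose_spec.1
  · exact fun x => (graph_succ _ _).1 (isFunctional φ A _ ArithFunc.succ ![x]).choose_spec.1

end pairFormulas

/-- The query whose universe consists of pairs, with arbitrary formulas for the relation symbols. -/
def pairQuery : FOQuery σ σ' where
  toQueryFormulas := pairFormulas φ
  isFunctional := pairFormulas.isFunctional φ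
  isArithmetic := pairFormulas.isArithmetic φ

end PairQuery

/-! ## The formula for the family of traces -/

section TraceFormula

variable {σ : Vocabulary} {α : Type}

/-- The formula `InTrace i v`. The bound variables are `T`, `K`, `m`, `T * T`, `K * K`, `K * K + m`,
the quotient `q` of `v` by `m`, `q * m`, the remainder `r`, `r * K`, `r * K + K`, the divisor and the
cofactor. -/
def traceF (i v : α) : (arithLang σ).Formula α :=
  ∃' ∃' ∃' ∃' ∃' ∃' ∃' ∃' ∃' ∃' ∃' ∃' ∃'
    (ltF zeroT (&2) ⊓ leF (&2) (&1) ⊓ multF (&0) (&0) (&3) ⊓ multF (&1) (&1) (&4) ⊓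
      addF (&4) (&2) (&5) ⊓ leF (&5) (&0) ⊓ addF (&3) (&5) (freeVar i) ⊓
      multF (&6) (&2) (&7) ⊓ addF (&7) (&8) (freeVar v) ⊓ ltF (&8) (&2) ⊓
      multF (&8) (&1) (&9) ⊓ addF (&9) (&1) (&10) ⊓ nextF (&10) (&11) ⊓
      multF (&11) (&12) (&0))

/-- Restricting the witnesses to the universe loses nothing: `T * T` and `K * K + m` are summands of
the code, divisor and cofactor are at most `T > 0`, and quotient and remainder are at most the value
of `v`. -/
theorem realize_traceF {A : Struc σ} (i v : α) (x : α → A.carrier) :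
    (traceF (σ := σ) i v).Realize x ↔ InTrace (A.val (x i)) (A.val (x v)) := by
  simp [traceF, Formula.Realize, Fin.snoc]
  constructor
  · rintro ⟨T, K, m, TT, KK, c, q, p, r, g, h, f, H, z, h14⟩
    simp only [and_assoc] at H
    obtain ⟨h1, h2, h3, h4, h5, h6, h7, h8, h9, h10, h11, h12, h13⟩ := H
    have hr : A.val (x v) % A.val m = A.val r := by
      rw [← h9, ← h8, mul_comm, Nat.mul_add_mod, Nat.mod_eq_of_lt h10]
    refine ⟨A.val T, A.val K, A.val m, h1, h2, by omega, by omega, A.val z, ?_⟩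
    rw [hr, ← h14, ← h13, ← h12, ← h11, Nat.succ_mul (A.val r)]
  · rintro ⟨T, K, m, hm, hK, hT, hi, z, hz⟩
    have hle := A.val_le (x i)
    have hT1 : T ≤ T * T := Nat.le_mul_self T
    have hK1 : K ≤ K * K := Nat.le_mul_self K
    have hdm : A.val (x v) / m * m + A.val (x v) % m = A.val (x v) := Nat.div_add_mod' _ _
    have hvle := A.val_le (x v)
    have hdle : A.val (x v) / m ≤ A.val (x v) := Nat.div_le_self _ _
    have hz0 : 0 < z := by
      rcases Nat.eq_zero_or_pos z with rfl | h
      · omega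
      · exact h
    have hf : (A.val (x v) % m + 1) * K + 1 ≤ T := by
      rw [hz]
      exact Nat.le_mul_of_pos_right _ hz0
    have hzT : z ≤ T := by
      rw [hz]
      exact Nat.le_mul_of_pos_left _ (Nat.succ_pos _)
    rw [Nat.succ_mul (A.val (x v) % m)] at hz hf
    have hlt := Nat.mod_lt (A.val (x v)) hm
    refine ⟨A.elem T (by omega), A.elem K (by omega), A.elem m (by omega),
      A.elem (T * T) (by omega), A.elem (K * K) (by omega), A.elem (K * K + m) (by omega),
      A.elem (A.val (x v) / m) (by omega), A.elem (A.val (x v) / m * m) (by omega),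
      A.elem (A.val (x v) % m) (by omega), A.elem (A.val (x v) % m * K) (by omega),
      A.elem (A.val (x v) % m * K + K) (by omega),
      A.elem (A.val (x v) % m * K + K + 1) (by omega), ?_, A.elem z (by omega), ?_⟩
    · simp only [Struc.val_elem, and_assoc, and_true]
      exact ⟨hm, hK, hT, hi.symm, hdm, hlt⟩
    · simp only [Struc.val_elem]
      exact hz.symm

end TraceFormula

/-! ## Constants and finite disjunctions -/

section Constants

variable {σ : Vocabulary} {α β : Type} {n : ℕ}

/-- The term for the element at position `j`. -/
def constT : ℕ → (arithLang σ).Term α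
  | 0 => zeroT
  | j + 1 => succT (constT j)

@[simp] theorem val_realize_constT {A : Struc σ} (j : ℕ) (v : α → A.carrier) :
    A.val ((constT (σ := σ) j).realize v) = min j A.top := by
  induction j with
  | zero => simp [constT]
  | succ j ih =>
    rw [constT, val_realize_succT, ih]
    omega

/-- The formula saying that the maximal position is at most `g`. -/
def topLeF (g : ℕ) : (arithLang σ).BoundedFormula α n :=
  Term.bdEqual (constT g) (constT (g + 1))

/-- Numerals saturate at the maximum, so two consecutive ones coincide exactly from there on. The
test is an equation of terms, hence quantifier-free for every `g`. -/
theorem realize_topLeF {A : Struc σ} (g : ℕ) (v : α → A.carrier) (xs : Fin n → A.carrier) :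
    (topLeF (σ := σ) g).Realize v xs ↔ A.top ≤ g := by
  rw [topLeF, realize_eqF, val_realize_constT, val_realize_constT]
  omega

/-- The disjunction of a family of formulas over a list. -/
def orList (l : List β) (φ : β → (arithLang σ).BoundedFormula α n) :
    (arithLang σ).BoundedFormula α n :=
  l.foldr (fun b ψ => φ b ⊔ ψ) ⊥

theorem realize_orList {A : Struc σ} (l : List β) (φ : β → (arithLang σ).BoundedFormula α n)
    (v : α → A.carrier) (xs : Fin n → A.carrier) :
    (orList l φ).Realize v xs ↔ ∃ b ∈ l, (φ b).Realize v xs := by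
  induction l with
  | nil => simp [orList]
  | cons b l ih =>
    rw [orList] at ih
    simp [orList, ih]

/-- All lists of `k` numbers that are at most `g`. -/
def tuples (g : ℕ) : ℕ → List (List ℕ)
  | 0 => [ [] ]
  | k + 1 => (tuples g k).flatMap fun l => (List.range (g + 1)).map fun x => x :: l

theorem mem_tuples {g k : ℕ} {l : List ℕ} :
    l ∈ tuples g k ↔ l.length = k ∧ ∀ x ∈ l, x ≤ g := by
  induction k generalizing l with
  | zero =>
    simp only [tuples, List.mem_singleton, List.length_eq_zero_iff]
    exact ⟨by rintro rfl; simp, fun h => h.1⟩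
  | succ k ih =>
    simp only [tuples, List.mem_flatMap, List.mem_map, List.mem_range, ih]
    constructor
    · rintro ⟨l', ⟨h1, h2⟩, x, hx, rfl⟩
      refine ⟨by simp [h1], fun y hy => ?_⟩
      rcases List.mem_cons.1 hy with rfl | hy
      · omega
      · exact h2 y hy
    · rintro ⟨h1, h2⟩
      match l with
      | [] => simp at h1
      | x :: l' =>
        exact ⟨l', ⟨by simpa using h1, fun y hy => h2 y (List.mem_cons_of_mem _ hy)⟩, x,
          Nat.lt_succ_of_le (h2 x List.mem_cons_self), rfl⟩

end Constants

namespace Struc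

variable {σ : Vocabulary} (A : Struc σ)

/-- In small structures, the sets of size at most `k` are those that are covered by a tuple. -/
theorem ncard_le_iff {g k : ℕ} (hg : A.top ≤ g) (X : Set A.carrier) :
    X.ncard ≤ k ↔ ∃ l ∈ tuples g k, ∀ v ∈ X, ∃ x ∈ l, A.val v = min x A.top := by
  classical
  constructor
  · intro h
    set Y := (A.val '' X).toFinite.toFinset with hY
    have hcard : Y.card = X.ncard := by
      rw [hY, ← Set.ncard_eq_toFinset_card _ (A.val '' X).toFinite,
        Set.ncard_image_of_injective _ A.val_injective]
    -- Zeros pad the list to length exactly `k`; a covering tuple may name superfluous elements.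
    refine ⟨Y.toList ++ List.replicate (k - X.ncard) 0, mem_tuples.2 ⟨?_, ?_⟩, ?_⟩
    · simp [hcard, h]
    · intro x hx
      simp only [List.mem_append, Finset.mem_toList, List.mem_replicate] at hx
      rcases hx with hx | hx
      · simp only [hY, Set.Finite.mem_toFinset] at hx
        obtain ⟨v, -, rfl⟩ := hx
        exact (A.val_le v).trans hg
      · omega
    · intro v hv
      refine ⟨A.val v, ?_, (min_eq_left (A.val_le v)).symm⟩
      simp only [List.mem_append, Finset.mem_toList]
      exact Or.inl ((Set.Finite.mem_toFinset _).2 ⟨v, hv, rfl⟩)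
  · rintro ⟨l, hl, h⟩
    have hsub : A.val '' X ⊆ ((l.map fun x => min x A.top).toFinset : Set ℕ) := by
      rintro _ ⟨v, hv, rfl⟩
      obtain ⟨x, hx, hvx⟩ := h v hv
      simp only [List.coe_toFinset, List.mem_map, Set.mem_ofPred_eq]
      exact ⟨x, hx, hvx.symm⟩
    calc X.ncard = (A.val '' X).ncard := (Set.ncard_image_of_injective _ A.val_injective).symm
      _ ≤ _ := Set.ncard_le_ncard hsub (Finset.finite_toSet _)
      _ ≤ (l.map fun x => min x A.top).length := by
          rw [Set.ncard_coe_finset]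
          exact List.toFinset_card_le _
      _ = k := by rw [List.length_map, (mem_tuples.1 hl).1]

end Struc

/-! ## Deciding hitting set in small structures -/

section Decision

variable {α : Type} {n : ℕ}

/-- The formula `vertex(t)`. -/
def vertexF (t : (arithLang hyperVocab).Term (α ⊕ Fin n)) :
    (arithLang hyperVocab).BoundedFormula α n :=
  BoundedFormula.rel (L := arithLang hyperVocab) vertexSym ![t]

/-- The formula `hyperedge(t)`. -/
def hyperedgeF (t : (arithLang hyperVocab).Term (α ⊕ Fin n)) :
    (arithLang hyperVocab).BoundedFormula α n :=
  BoundedFormula.rel (L := arithLang hyperVocab) hyperedgeSym ![t]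

/-- The formula `in(t, u)`. -/
def inF (t u : (arithLang hyperVocab).Term (α ⊕ Fin n)) :
    (arithLang hyperVocab).BoundedFormula α n :=
  BoundedFormula.rel (L := arithLang hyperVocab) inSym ![t, u]

variable {A : Struc hyperVocab} (t u : (arithLang hyperVocab).Term (α ⊕ Fin n)) (v : α → A.carrier)
  (xs : Fin n → A.carrier)

@[simp] theorem realize_vertexF :
    (vertexF t).Realize v xs ↔ t.realize (Sum.elim v xs) ∈ A.vertices := by
  rw [vertexF, BoundedFormula.Realize, Struc.vertices, Set.mem_ofPred_eq]
  congr! 1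
  funext i
  fin_cases i
  rfl

@[simp] theorem realize_hyperedgeF :
    (hyperedgeF t).Realize v xs ↔ t.realize (Sum.elim v xs) ∈ A.hyperedges := by
  rw [hyperedgeF, BoundedFormula.Realize, Struc.hyperedges, Set.mem_ofPred_eq]
  congr! 1
  funext i
  fin_cases i
  rfl

@[simp] theorem realize_inF :
    (inF t u).Realize v xs ↔ t.realize (Sum.elim v xs) ∈ A.set (u.realize (Sum.elim v xs)) := by
  rw [inF, BoundedFormula.Realize, Struc.set, Set.mem_ofPred_eq]
  congr! 1
  funext i
  fin_cases i <;> rfl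

/-- Every hyperedge is a set of vertices. -/
def edgesSubsetF : (arithLang hyperVocab).BoundedFormula α 0 :=
  ∀' (hyperedgeF (&0) ⟹ ∀' (inF (&1) (&0) ⟹ vertexF (&1)))

/-- The hyperedge `&0` is hit by the tuple `l`. -/
def hitF (l : List ℕ) : (arithLang hyperVocab).BoundedFormula α 1 :=
  hyperedgeF (&0) ⟹ orList l fun x => inF (constT x) (&0)

/-- The hyperedge `&0` is covered by the tuple `l`. -/
def coverF (l : List ℕ) : (arithLang hyperVocab).BoundedFormula α 1 :=
  ∀' (inF (&1) (&0) ⟹ orList l fun x => Term.bdEqual (&1) (constT x))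

/-- In structures with maximal position at most `g`, this formula defines the hitting set problem. -/
def decisionF (k d g : ℕ) : (arithLang hyperVocab).BoundedFormula α 0 :=
  edgesSubsetF ⊓ (∀' (hyperedgeF (&0) ⟹ orList (tuples g d) coverF)) ⊓
    orList (tuples g k) fun l => ∀' (hitF l)

/-- Vertex set and edge family determine `H`, and the pairing determines `k` and `d`. What is left
are conditions on elements of `A`. -/
theorem mem_hittingSet_iff (A : Struc hyperVocab) (k d : ℕ) :
    (A, Nat.pair k d) ∈ hittingSet ↔ (∀ e ∈ A.hyperedges, A.set e ⊆ A.vertices) ∧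
      (∀ e ∈ A.hyperedges, (A.set e).ncard ≤ d) ∧
      ∃ X ⊆ A.vertices, (∀ e ∈ A.hyperedges, (A.set e ∩ X).Nonempty) ∧ X.ncard ≤ k := by
  constructor
  · rintro ⟨k', d', h, H, hV, hE, hd, X, ⟨hXV, hX⟩, hk⟩
    obtain ⟨rfl, rfl⟩ := Nat.pair_eq_pair.1 h
    dsimp only at hV hE hd hXV hX
    have hmem : ∀ e ∈ A.hyperedges, A.set e ∈ H.edgeSet := fun e he => hE ▸ ⟨e, he, rfl⟩
    exact ⟨fun e he => hV ▸ H.subset_vertexSet_of_mem_edgeSet' (hmem e he),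
      fun e he => hd _ (hmem e he), X, hV ▸ hXV, fun e he => hX _ (hmem e he), hk⟩
  · rintro ⟨hV, hd, X, hXV, hX, hk⟩
    refine ⟨k, d, rfl, ⟨A.vertices, A.edgeFamily, ?_⟩, rfl, rfl, ?_, X, ⟨hXV, ?_⟩, hk⟩
    · rintro _ ⟨e, he, rfl⟩
      exact hV e he
    · rintro _ ⟨e, he, rfl⟩
      exact hd e he
    · rintro _ ⟨e, he, rfl⟩
      exact hX e he

theorem realize_edgesSubsetF (xs : Fin 0 → A.carrier) : edgesSubsetF.Realize v xs ↔
    ∀ e ∈ A.hyperedges, A.set e ⊆ A.vertices := by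
  simp [edgesSubsetF, Fin.snoc, Set.subset_def]

theorem realize_hitF (l : List ℕ) (xs : Fin 1 → A.carrier) : (hitF l).Realize v xs ↔
    (xs 0 ∈ A.hyperedges → ∃ w ∈ A.set (xs 0), ∃ x ∈ l, A.val w = min x A.top) := by
  simp only [hitF, BoundedFormula.realize_imp, realize_hyperedgeF, realize_orList, realize_inF]
  refine imp_congr_right fun _ => ⟨?_, ?_⟩
  · rintro ⟨x, hx, h⟩
    exact ⟨_, h, x, hx, by simp⟩
  · rintro ⟨w, hw, x, hx, h⟩
    have h' : (constT x).realize (Sum.elim v xs) = w :=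
      A.val_injective ((val_realize_constT x _).trans h.symm)
    exact ⟨x, hx, h' ▸ hw⟩

theorem realize_coverF (l : List ℕ) (xs : Fin 1 → A.carrier) : (coverF l).Realize v xs ↔
    ∀ w ∈ A.set (xs 0), ∃ x ∈ l, A.val w = min x A.top := by
  simp [coverF, realize_orList, realize_eqF, -BoundedFormula.realize_bdEqual, Fin.snoc]

theorem realize_decisionF {k d g : ℕ} (hg : A.top ≤ g) (xs : Fin 0 → A.carrier) :
    (decisionF k d g).Realize v xs ↔ (A, Nat.pair k d) ∈ hittingSet := by
  simp only [decisionF, BoundedFormula.realize_inf, realize_edgesSubsetF, realize_orList,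
    BoundedFormula.realize_all, BoundedFormula.realize_imp, realize_hyperedgeF, realize_hitF,
    realize_coverF, mem_hittingSet_iff, A.ncard_le_iff hg, and_assoc]
  refine and_congr_right fun hV => and_congr Iff.rfl ⟨?_, ?_⟩
  · rintro ⟨l, hl, h⟩
    -- The tuple may name non-vertices; dropping them loses no hit because hyperedges consist of
    -- vertices.
    refine ⟨{w ∈ A.vertices | ∃ x ∈ l, A.val w = min x A.top}, Set.sep_subset _ _, fun e he => ?_,
      l, hl, fun w hw => hw.2⟩
    obtain ⟨w, hw, hx⟩ := h e he
    exact ⟨w, hw, hV e he hw, hx⟩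
  · rintro ⟨X, hXV, hX, l, hl, h⟩
    refine ⟨l, hl, fun e he => ?_⟩
    obtain ⟨w, hw, hwX⟩ := hX e he
    exact ⟨w, hw, h w hwX⟩

end Decision

/-! ## Computability of Gödel numbers -/

section Codes

variable {σ : Vocabulary} {α β γ : Type} [Encodable α] [Primcodable β] [Primcodable γ] {n : ℕ}

/-- The terms of the family have primitive recursive Gödel numbers. -/
def PrimrecTerms (t : β → (arithLang σ).Term α) : Prop := Primrec fun b => termCode (t b)

/-- The formulas of the family have primitive recursive Gödel numbers. -/
def PrimrecFormulas (φ : β → (arithLang σ).BoundedFormula α n) : Prop :=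
  Primrec fun b => formulaCode (φ b)

theorem PrimrecTerms.const (t : (arithLang σ).Term α) : PrimrecTerms fun _ : β => t :=
  Primrec.const _

theorem PrimrecTerms.constT {f : β → ℕ} (hf : Primrec f) :
    PrimrecTerms fun b => (constT (f b) : (arithLang σ).Term α) := by
  have h : Primrec fun j => termCode (_root_.constT j : (arithLang σ).Term α) := by
    -- The tag `2` is `1 + funcCode ArithFunc.succ`.
    have hstep : Primrec₂ fun (_ : ℕ) (c : ℕ) => Nat.pair 2 (Encodable.encode [c]) :=
      Primrec₂.natPair.comp₂ (Primrec₂.const 2)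
        (Primrec.encode.comp₂ (Primrec.list_cons.comp₂ Primrec₂.right (Primrec₂.const [])))
    refine (Primrec.nat_rec₁ (termCode (zeroT : (arithLang σ).Term α)) hstep).of_eq fun j => ?_
    induction j with
    | zero => rfl
    | succ j ih =>
      simp only [ih]
      simp [_root_.constT, succT, termCode, funcCode]
  exact h.comp hf

namespace PrimrecFormulas

variable {φ ψ : β → (arithLang σ).BoundedFormula α n}

theorem const (φ : (arithLang σ).BoundedFormula α n) : PrimrecFormulas fun _ : β => φ :=
  Primrec.const _

theorem imp (hφ : PrimrecFormulas φ) (hψ : PrimrecFormulas ψ) :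
    PrimrecFormulas fun b => (φ b).imp (ψ b) :=
  Primrec₂.natPair.comp (Primrec.const 2) (Primrec₂.natPair.comp hφ hψ)

theorem all {φ : β → (arithLang σ).BoundedFormula α (n + 1)} (hφ : PrimrecFormulas φ) :
    PrimrecFormulas fun b => (φ b).all :=
  Primrec₂.natPair.comp (Primrec.const 3) hφ

theorem not (hφ : PrimrecFormulas φ) : PrimrecFormulas fun b => ∼(φ b) :=
  hφ.imp (const ⊥)

theorem sup (hφ : PrimrecFormulas φ) (hψ : PrimrecFormulas ψ) :
    PrimrecFormulas fun b => φ b ⊔ ψ b :=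
  hφ.not.imp hψ

theorem inf (hφ : PrimrecFormulas φ) (hψ : PrimrecFormulas ψ) :
    PrimrecFormulas fun b => φ b ⊓ ψ b :=
  (hφ.imp hψ.not).not

theorem bdEqual {t u : β → (arithLang σ).Term (α ⊕ Fin n)} (ht : PrimrecTerms t)
    (hu : PrimrecTerms u) : PrimrecFormulas fun b => Term.bdEqual (t b) (u b) :=
  Primrec₂.natPair.comp (Primrec.const 1) (Primrec₂.natPair.comp ht hu)

theorem rel₂ (R : ArithRel σ 2) {t u : β → (arithLang σ).Term (α ⊕ Fin n)} (ht : PrimrecTerms t)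
    (hu : PrimrecTerms u) : PrimrecFormulas fun b =>
      (BoundedFormula.rel (L := arithLang σ) R ![t b, u b] : (arithLang σ).BoundedFormula α n) := by
  refine (Primrec₂.natPair.comp (Primrec.const (4 + relCode R)) (Primrec.encode.comp
    (Primrec.list_cons.comp ht (Primrec.list_cons.comp hu (Primrec.const []))))).of_eq fun b => ?_
  simp [formulaCode]

theorem orList {l : β → List γ} {φ : β → γ → (arithLang σ).BoundedFormula α n}
    (hl : Primrec l) (hφ : PrimrecFormulas fun p : β × γ => φ p.1 p.2) :
    PrimrecFormulas fun b => orList (l b) (φ b) := by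
  -- A disjunction `φ ⊔ ψ` is `∼φ ⟹ ψ`, and `∼φ` is `φ ⟹ ⊥`; both implications carry the tag `2`.
  have hstep : Primrec₂ fun (b : β) (p : γ × ℕ) => Nat.pair 2 (Nat.pair
      (Nat.pair 2 (Nat.pair (formulaCode (φ b p.1))
        (formulaCode (⊥ : (arithLang σ).BoundedFormula α n)))) p.2) := by
    have h1 : Primrec₂ fun (b : β) (p : γ × ℕ) => formulaCode (φ b p.1) :=
      Primrec.comp (f := fun p : β × γ => formulaCode (φ p.1 p.2)) hφ
        (Primrec.pair Primrec.fst (Primrec.fst.comp Primrec.snd))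
    exact Primrec₂.natPair.comp₂ (Primrec₂.const 2) (Primrec₂.natPair.comp₂
      (Primrec₂.natPair.comp₂ (Primrec₂.const 2) (Primrec₂.natPair.comp₂ h1 (Primrec₂.const _)))
      (Primrec.snd.comp₂ Primrec₂.right))
  refine (Primrec.list_foldr hl
    (Primrec.const (formulaCode (⊥ : (arithLang σ).BoundedFormula α n))) hstep).of_eq fun b => ?_
  dsimp only
  induction l b with
  | nil => rfl
  | cons c l ih =>
    rw [List.foldr_cons, ih]
    rfl

theorem topLeF {g : β → ℕ} (hg : Primrec g) :
    PrimrecFormulas fun b => (topLeF (g b) : (arithLang σ).BoundedFormula α n) :=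
  bdEqual (PrimrecTerms.constT hg) (PrimrecTerms.constT (Primrec.succ.comp hg))

end PrimrecFormulas

theorem primrec_tuples : Primrec₂ tuples := by
  have hstep : Primrec₂ fun (g : ℕ) (p : ℕ × List (List ℕ)) =>
      p.2.flatMap fun l => (List.range (g + 1)).map fun x => x :: l := by
    refine Primrec.list_flatMap (Primrec.snd.comp Primrec.snd) ?_
    refine Primrec.list_map (Primrec.list_range.comp (Primrec.succ.comp
      (Primrec.fst.comp Primrec.fst))) ?_
    exact Primrec.list_cons.comp₂ Primrec₂.right (Primrec.snd.comp₂ Primrec₂.left)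
  refine (Primrec.nat_rec (Primrec.const [ [] ]) hstep).of_eq fun g k => ?_
  induction k with
  | zero => rfl
  | succ k ih =>
    simp only [tuples, ← ih]

theorem primrec_traceBound : Primrec traceBound := by
  have hmul : ∀ {f g : ℕ → ℕ}, Primrec f → Primrec g → Primrec fun d => f d * g d :=
    fun hf hg => Primrec.nat_mul.comp hf hg
  have hadd : ∀ {f g : ℕ → ℕ}, Primrec f → Primrec g → Primrec fun d => f d + g d :=
    fun hf hg => Primrec.nat_add.comp hf hg
  have hdd : Primrec fun d : ℕ => d * d := hmul Primrec.id Primrec.id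
  have hE : Primrec traceExp :=
    hadd (.const 2) (hmul (.const 4) (hadd (hmul (.const 3) (hadd hdd (.const 1)))
      (hmul (hadd hdd (.const 3)) .id)))
  have hL : Primrec traceLog := hmul (hmul (hmul (.const 64) hE) hE) (hadd hdd (.const 1))
  have hpow : Primrec fun e : ℕ => 2 ^ e := by
    refine (Primrec.nat_rec₁ 1 (Primrec.nat_mul.comp₂ Primrec₂.right (Primrec₂.const 2))).of_eq
      fun e => ?_
    induction e with
    | zero => rfl
    | succ e ih => simp only [ih, pow_succ]
  exact hpow.comp hL

theorem PrimrecFormulas.decisionF {k d g : β → ℕ} (hk : Primrec k) (hd : Primrec d)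
    (hg : Primrec g) : PrimrecFormulas fun b =>
      (decisionF (k b) (d b) (g b) : (arithLang hyperVocab).BoundedFormula α 0) := by
  refine ((const edgesSubsetF).inf (imp (const _) (orList (primrec_tuples.comp hg hd) ?_)).all).inf
    (orList (primrec_tuples.comp hg hk) (all ?_))
  · exact all (imp (const _) (orList Primrec.snd (bdEqual (.const _) (.constT Primrec.snd))))
  · exact imp (const _) (orList Primrec.snd (rel₂ _ (.constT Primrec.snd) (.const _)))

end Codes

/-! ## Quantifier ranks -/

section Rank

variable {L : Language} {α : Type} {n : ℕ}

@[simp] theorem quantRank_not (φ : L.BoundedFormula α n) : quantRank (∼φ) = quantRank φ :=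
  Nat.max_eq_left (Nat.zero_le _)

@[simp] theorem quantRank_imp (φ ψ : L.BoundedFormula α n) :
    quantRank (φ.imp ψ) = max (quantRank φ) (quantRank ψ) := rfl

@[simp] theorem quantRank_all (φ : L.BoundedFormula α (n + 1)) :
    quantRank φ.all = quantRank φ + 1 := rfl

@[simp] theorem quantRank_sup (φ ψ : L.BoundedFormula α n) :
    quantRank (φ ⊔ ψ) = max (quantRank φ) (quantRank ψ) := by
  change max (quantRank (∼φ)) (quantRank ψ) = _
  rw [quantRank_not]

@[simp] theorem quantRank_inf (φ ψ : L.BoundedFormula α n) :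
    quantRank (φ ⊓ ψ) = max (quantRank φ) (quantRank ψ) := by
  change quantRank (∼(φ.imp ∼ψ)) = _
  rw [quantRank_not, quantRank_imp, quantRank_not]

@[simp] theorem quantRank_bdEqual (t u : L.Term (α ⊕ Fin n)) : quantRank (Term.bdEqual t u) = 0 :=
  rfl

@[simp] theorem quantRank_rel {m : ℕ} (R : L.Relations m) (ts : Fin m → L.Term (α ⊕ Fin n)) :
    quantRank (BoundedFormula.rel R ts) = 0 := rfl

theorem quantRank_orList_le {σ : Vocabulary} {β : Type} {c : ℕ} (l : List β)
    {φ : β → (arithLang σ).BoundedFormula α n} (h : ∀ b, quantRank (φ b) ≤ c) :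
    quantRank (orList l φ) ≤ c := by
  induction l with
  | nil => exact Nat.zero_le _
  | cons b l ih => exact (quantRank_sup _ _).trans_le (max_le (h b) ih)

/-- Numerals are terms and finite disjunctions do not add rank. Only the quantifiers over a
hyperedge and its elements count, whatever `k`, `d` and `g` are. -/
theorem quantRank_decisionF_le (k d g : ℕ) :
    quantRank (decisionF k d g : (arithLang hyperVocab).BoundedFormula α 0) ≤ 2 := by
  simp only [decisionF, edgesSubsetF, quantRank_inf, quantRank_all, quantRank_imp, hyperedgeF, inF,
    vertexF, quantRank_rel, max_le_iff]
  refine ⟨⟨by norm_num, ?_⟩, ?_⟩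
  · refine Nat.succ_le_succ (max_le (Nat.zero_le _) (quantRank_orList_le _ fun l => ?_))
    refine Nat.succ_le_succ (max_le (Nat.zero_le _) (quantRank_orList_le _ fun x => ?_))
    exact le_rfl
  · refine quantRank_orList_le _ fun l => Nat.succ_le_succ (max_le (Nat.zero_le _) ?_)
    exact quantRank_orList_le _ fun x => Nat.zero_le _

end Rank

/-! ## The reduction -/

/-- The formula for `vertex`: the second digit is `0` and the first digit is a vertex. -/
def newVertexF : (arithLang hyperVocab).Formula (Fin 1 × Fin 2) :=
  vertexF (freeVar (0, 0)) ⊓ Term.bdEqual (freeVar (0, 1)) zeroT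

/-- The formula for `hyperedge`: in large structures, the hyperedges remain the same. In small ones,
all elements are hyperedges if there is no hitting set, and otherwise there are no hyperedges. -/
def newHyperedgeF (k d : ℕ) : (arithLang hyperVocab).Formula (Fin 1 × Fin 2) :=
  (∼(topLeF (traceBound d)) ⊓
    (hyperedgeF (freeVar (0, 0)) ⊓ Term.bdEqual (freeVar (0, 1)) zeroT)) ⊔
  (topLeF (traceBound d) ⊓ ∼(decisionF k d (traceBound d)))

/-- `(v, 0)` belongs to `(e, i)` if `v` belongs to `e` and either `i = 0` or `v` belongs to the
`i`-th trace. -/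
def traceInF : (arithLang hyperVocab).Formula (Fin 2 × Fin 2) :=
  Term.bdEqual (freeVar (0, 1)) zeroT ⊓ inF (freeVar (0, 0)) (freeVar (1, 0)) ⊓
    (Term.bdEqual (freeVar (1, 1)) zeroT ⊔ traceF (1, 1) (0, 0))

/-- The formula for `in`. In small structures, all represented sets are empty. -/
def newInF (d : ℕ) : (arithLang hyperVocab).Formula (Fin 2 × Fin 2) :=
  ∼(topLeF (traceBound d)) ⊓ traceInF

/-- The formulas for the symbols of the vocabulary of hypergraphs. -/
def newSymF (k d : ℕ) : (i : Fin hyperVocab.numRel) →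
    (arithLang hyperVocab).Formula (Fin (hyperVocab.arity i) × Fin 2)
  | ⟨0, _⟩ => newVertexF
  | ⟨1, _⟩ => newHyperedgeF k d
  | ⟨2, _⟩ => newInF d

/-- The queries of the reduction. -/
def closureQuery (p : ℕ) : FOQuery hyperVocab hyperVocab :=
  pairQuery (newSymF p.unpair.1 p.unpair.2)

/-! ### Correctness of the reduction. -/

section Correctness

variable {A : Struc hyperVocab} {p : ℕ}

/-- The first digit of an element of the new structure. -/
def fstElem (x : ((closureQuery p).apply A).carrier) : A.carrier := x.1 (0 : Fin 2)

/-- The position of the second digit of an element of the new structure. -/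
noncomputable def sndVal (x : ((closureQuery p).apply A).carrier) : ℕ := A.val (x.1 (1 : Fin 2))

theorem exists_pair (a : A.carrier) {b : ℕ} (hb : b * b ≤ A.top) :
    ∃ x : ((closureQuery p).apply A).carrier, fstElem x = a ∧ sndVal x = b := by
  obtain ⟨x, h0, h1⟩ := pairFormulas.exists_digits (φ := newSymF p.unpair.1 p.unpair.2)
    (A.val_le a) (Nat.le_sqrt.2 hb)
  exact ⟨x, A.val_injective h0, h1⟩

theorem pair_ext {x y : ((closureQuery p).apply A).carrier} (h0 : fstElem x = fstElem y)
    (h1 : sndVal x = sndVal y) : x = y :=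
  pairFormulas.ext_digits (φ := newSymF p.unpair.1 p.unpair.2) (congrArg A.val h0) h1

theorem mem_vertices_closureQuery (x : ((closureQuery p).apply A).carrier) :
    x ∈ ((closureQuery p).apply A).vertices ↔ fstElem x ∈ A.vertices ∧ sndVal x = 0 := by
  change newVertexF.Realize (fun q : Fin 1 × Fin 2 => (![x] q.1).1 q.2) ↔ _
  simp only [newVertexF, Formula.Realize, BoundedFormula.realize_inf, realize_vertexF, realize_eqF,
    val_realize_zeroT]
  rfl

theorem mem_hyperedges_closureQuery (x : ((closureQuery p).apply A).carrier) :
    x ∈ ((closureQuery p).apply A).hyperedges ↔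
      (traceBound p.unpair.2 < A.top ∧ fstElem x ∈ A.hyperedges ∧ sndVal x = 0) ∨
      (A.top ≤ traceBound p.unpair.2 ∧ (A, p) ∉ hittingSet) := by
  change (newHyperedgeF p.unpair.1 p.unpair.2).Realize
    (fun q : Fin 1 × Fin 2 => (![x] q.1).1 q.2) ↔ _
  simp only [newHyperedgeF, Formula.Realize, BoundedFormula.realize_sup, BoundedFormula.realize_inf,
    BoundedFormula.realize_not, realize_hyperedgeF, realize_eqF, realize_topLeF, val_realize_zeroT,
    not_le]
  refine or_congr Iff.rfl (and_congr_right fun h => not_congr ?_)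
  exact (realize_decisionF _ h _).trans (by rw [Nat.pair_unpair])

theorem mem_set_closureQuery (x e : ((closureQuery p).apply A).carrier) :
    x ∈ ((closureQuery p).apply A).set e ↔ traceBound p.unpair.2 < A.top ∧
      sndVal x = 0 ∧ fstElem x ∈ A.set (fstElem e) ∧
        (sndVal e = 0 ∨ InTrace (sndVal e) (A.val (fstElem x))) := by
  change (newInF p.unpair.2).Realize (fun q : Fin 2 × Fin 2 => (![x, e] q.1).1 q.2) ↔ _
  have h := realize_traceF (σ := hyperVocab) (A := A) ((1, 1) : Fin 2 × Fin 2) (0, 0)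
    (fun q : Fin 2 × Fin 2 => (![x, e] q.1).1 q.2)
  rw [Formula.Realize] at h
  simp only [newInF, traceInF, Formula.Realize, BoundedFormula.realize_inf,
    BoundedFormula.realize_sup, BoundedFormula.realize_not, realize_inF, realize_eqF,
    realize_topLeF, val_realize_zeroT, not_le, h, and_assoc]
  rfl

/-- All represented sets are empty here. A yes-instance yields no hyperedges, so the empty set is a
hitting set and closure is vacuous; a no-instance turns every element into an empty hyperedge, which
nothing hits. -/
theorem closureQuery_correct_of_le (h : A.top ≤ traceBound p.unpair.2) :
    (A, p) ∈ hittingSet ↔ ((closureQuery p).apply A, p) ∈ hittingSet' := by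
  set B := (closureQuery p).apply A with hB
  have hset : ∀ e : B.carrier, B.set e = ∅ := fun e =>
    Set.eq_empty_of_forall_notMem fun x hx =>
      absurd ((mem_set_closureQuery x e).1 hx).1 (Nat.not_lt.2 h)
  constructor
  · intro hA
    have hedges : ∀ e : B.carrier, e ∉ B.hyperedges := fun e he => by
      rcases (mem_hyperedges_closureQuery e).1 he with h' | h'
      · exact absurd h'.1 (Nat.not_lt.2 h)
      · exact h'.2 hA
    refine ⟨?_, fun e he => absurd he (hedges e)⟩
    have := (mem_hittingSet_iff B p.unpair.1 p.unpair.2).2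
      ⟨fun e he => absurd he (hedges e), fun e he => absurd he (hedges e), ∅, Set.empty_subset _,
        fun e he => absurd he (hedges e), by simp⟩
    rwa [Nat.pair_unpair] at this
  · rintro ⟨hmem, -⟩
    by_contra hA
    rw [← Nat.pair_unpair p, mem_hittingSet_iff] at hmem
    obtain ⟨-, -, X, -, hX, -⟩ := hmem
    -- The pair `(0, 0)` always exists, so there is at least one empty hyperedge.
    obtain ⟨e, -⟩ := exists_pair (p := p) (A := A) (A.elem 0 (Nat.zero_le _)) (b := 0) (by simp)
    have := hX e ((mem_hyperedges_closureQuery e).2 (Or.inr ⟨h, hA⟩))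
    simp [hset] at this

/-- The problem `hittingSet` is invariant under embeddings of hypergraphs that are onto the vertices
and the hyperedges. -/
theorem mem_hittingSet_iff_of_embedding {A B : Struc hyperVocab} {f : A.carrier → B.carrier}
    (hf : Function.Injective f) (hV : B.vertices = f '' A.vertices)
    (hE : B.hyperedges = f '' A.hyperedges)
    (hset : ∀ e ∈ A.hyperedges, B.set (f e) = f '' A.set e) (k d : ℕ) :
    (A, Nat.pair k d) ∈ hittingSet ↔ (B, Nat.pair k d) ∈ hittingSet := by
  rw [mem_hittingSet_iff, mem_hittingSet_iff, hV, hE]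
  simp only [Set.forall_mem_image]
  refine and_congr (forall₂_congr fun e he => ?_) (and_congr (forall₂_congr fun e he => ?_) ?_)
  · rw [hset e he, Set.image_subset_image_iff hf]
  · rw [hset e he, Set.ncard_image_of_injective _ hf]
  · constructor
    · rintro ⟨X, hXV, hX, hk⟩
      refine ⟨f '' X, Set.image_mono hXV, fun e he => ?_, ?_⟩
      · rw [hset e he, ← Set.image_inter hf]
        exact (hX e he).image f
      · rwa [Set.ncard_image_of_injective _ hf]
    · rintro ⟨Y, hYV, hY, hk⟩
      obtain ⟨X, hXV, rfl⟩ := Set.subset_image_iff.1 hYV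
      refine ⟨X, hXV, fun e he => ?_, ?_⟩
      · have := hY he
        rwa [hset e he, ← Set.image_inter hf, Set.image_nonempty] at this
      · rwa [Set.ncard_image_of_injective _ hf] at hk

/-- The map `a ↦ (a, 0)` carries the old hypergraph onto the new one, which settles `hittingSet`.
Closure under subsets is needed only for yes-instances, whose hyperedges have at most `d` elements,
so `exists_inTrace` applies. -/
theorem closureQuery_correct_of_lt (h : traceBound p.unpair.2 < A.top) :
    (A, p) ∈ hittingSet ↔ ((closureQuery p).apply A, p) ∈ hittingSet' := by
  set B := (closureQuery p).apply A with hB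
  choose f hf0 hf1 using fun a : A.carrier => exists_pair (p := p) a (b := 0) (by simp)
  have hf : Function.Injective f := fun a b hab => by rw [← hf0 a, hab, hf0]
  have himage : ∀ (S : Set A.carrier) (x : B.carrier),
      x ∈ f '' S ↔ fstElem x ∈ S ∧ sndVal x = 0 := by
    intro S x
    constructor
    · rintro ⟨a, ha, rfl⟩
      exact ⟨(hf0 a).symm ▸ ha, hf1 a⟩
    · rintro ⟨h0, h1⟩
      exact ⟨_, h0, pair_ext (hf0 _) ((hf1 _).trans h1.symm)⟩
  have hV : B.vertices = f '' A.vertices := by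
    ext x
    rw [mem_vertices_closureQuery, himage]
  have hE : B.hyperedges = f '' A.hyperedges := by
    ext x
    rw [mem_hyperedges_closureQuery, himage]
    simp [h, Nat.not_le.2 h]
  have hset : ∀ e, B.set (f e) = f '' A.set e := by
    intro e
    ext x
    rw [mem_set_closureQuery, himage, hf0, hf1]
    simp [h, and_comm]
  have hiff := mem_hittingSet_iff_of_embedding hf hV hE (fun e _ => hset e) p.unpair.1 p.unpair.2
  rw [Nat.pair_unpair] at hiff
  refine hiff.trans ⟨fun hmem => ⟨hmem, ?_⟩, fun hmem => hmem.1⟩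
  intro e' he' s hs
  dsimp only at he' s hs ⊢
  rw [hE] at he'
  obtain ⟨e, he, rfl⟩ := he'
  rw [hset] at hs
  obtain ⟨t, ht, rfl⟩ := Set.subset_image_iff.1 hs
  have hd : (A.set e).ncard ≤ p.unpair.2 := by
    have := hiff.2 hmem
    rw [← Nat.pair_unpair p, mem_hittingSet_iff] at this
    exact this.2.1 e he
  obtain ⟨i, hi, hii, htrace⟩ := exists_inTrace (n := A.top)
    (e := ((A.set e).toFinite.image A.val).toFinset) (s := (t.toFinite.image A.val).toFinset)
    h.le (by simpa using Set.image_mono ht)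
    (by rwa [← Set.ncard_eq_toFinset_card _ ((A.set e).toFinite.image A.val),
      Set.ncard_image_of_injective _ A.val_injective])
    (by simpa using fun x _ => A.val_le x)
  obtain ⟨y, hy0, hy1⟩ := exists_pair (p := p) e hii
  refine ⟨y, ?_⟩
  ext x
  rw [mem_set_closureQuery, himage, hy0, hy1]
  constructor
  · rintro ⟨-, h1, h2, h3⟩
    refine ⟨?_, h1⟩
    -- As `i` is positive, membership must come from the trace and not from the clause for second
    -- digit `0`.
    have h4 := (htrace (A.val (fstElem x)) (by simpa using ⟨_, h2, rfl⟩)).1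
      (h3.resolve_left hi.ne')
    simpa [A.val_inj] using h4
  · rintro ⟨h1, h2⟩
    refine ⟨h, h2, ht h1, Or.inr ((htrace _ ?_).2 ?_)⟩
    · simpa using ⟨_, ht h1, rfl⟩
    · simpa using ⟨_, h1, rfl⟩

variable (A p) in
theorem closureQuery_correct :
    (A, p) ∈ hittingSet ↔ ((closureQuery p).apply A, p) ∈ hittingSet' :=
  (Nat.lt_or_ge (traceBound p.unpair.2) A.top).elim closureQuery_correct_of_lt
    closureQuery_correct_of_le

end Correctness

/-! ### Computability and bounded rank. -/

theorem computableQueries_closureQuery : ComputableQueries closureQuery := by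
  have hk : Primrec fun p : ℕ => p.unpair.1 := Primrec.fst.comp Primrec.unpair
  have hd : Primrec fun p : ℕ => p.unpair.2 := Primrec.snd.comp Primrec.unpair
  have hg := primrec_traceBound.comp hd
  refine ⟨Computable.const 2, Computable.const (formulaCode (pairUnivF (σ := hyperVocab))),
    fun n R => ?_, fun n F => ?_⟩
  · match n, R with
    | _, .lt => exact Computable.const (formulaCode (pairLtF (σ := hyperVocab)))
    | _, .add => exact Computable.const (formulaCode (pairAddF (σ := hyperVocab)))
    | _, .mult => exact Computable.const (formulaCode (pairMultF (σ := hyperVocab)))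
    | _, .sym ⟨0, _⟩ => exact Computable.const (formulaCode newVertexF)
    | _, .sym ⟨1, _⟩ =>
      have h : PrimrecFormulas fun p : ℕ => newHyperedgeF p.unpair.1 p.unpair.2 :=
        ((PrimrecFormulas.topLeF hg).not.inf (.const _)).sup
          ((PrimrecFormulas.topLeF hg).inf (PrimrecFormulas.decisionF hk hd hg).not)
      exact Primrec.to_comp h
    | _, .sym ⟨2, _⟩ =>
      have h : PrimrecFormulas fun p : ℕ => newInF p.unpair.2 :=
        (PrimrecFormulas.topLeF hg).not.inf (.const _)
      exact Primrec.to_comp h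
  · cases F with
    | zero => exact Computable.const (formulaCode (pairZeroF (σ := hyperVocab)))
    | succ => exact Computable.const (formulaCode (pairSuccF (σ := hyperVocab)))

theorem quantRank_newHyperedgeF_le (k d : ℕ) : quantRank (newHyperedgeF k d) ≤ 2 := by
  have := quantRank_decisionF_le (α := Fin 1 × Fin 2) k d (traceBound d)
  simp only [newHyperedgeF, quantRank_sup, quantRank_inf, quantRank_not, topLeF,
    quantRank_bdEqual, hyperedgeF, quantRank_rel]
  omega

theorem quantRank_newInF (d : ℕ) : quantRank (newInF d) = quantRank traceInF :=
  (quantRank_inf _ _).trans (max_eq_right (Nat.zero_le _))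

/-- Only `newHyperedgeF` and `newInF` depend on the parameter, and their ranks have bounds free of
it. The sum over all formulas is a crude common bound. -/
theorem exists_quantRank_closureQuery_le : ∃ c, ∀ p, quantRank (closureQuery p).univ ≤ c ∧
    (∀ (n : ℕ) (R : ArithRel hyperVocab n), quantRank ((closureQuery p).rel R) ≤ c) ∧
    ∀ (n : ℕ) (F : ArithFunc n), quantRank ((closureQuery p).func F) ≤ c := by
  refine ⟨(quantRank (pairUnivF (σ := hyperVocab)) + quantRank (pairLtF (σ := hyperVocab)) +
    quantRank (pairAddF (σ := hyperVocab)) + quantRank (pairMultF (σ := hyperVocab))) +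
    (quantRank newVertexF + 2 + quantRank traceInF) +
    (quantRank (pairZeroF (σ := hyperVocab)) + quantRank (pairSuccF (σ := hyperVocab))),
    fun p => ⟨?_, fun n R => ?_, fun n F => ?_⟩⟩
  · change quantRank (pairUnivF (σ := hyperVocab)) ≤ _
    omega
  · match n, R with
    | _, .lt =>
      change quantRank (pairLtF (σ := hyperVocab)) ≤ _
      omega
    | _, .add =>
      change quantRank (pairAddF (σ := hyperVocab)) ≤ _
      omega
    | _, .mult =>
      change quantRank (pairMultF (σ := hyperVocab)) ≤ _
      omega
    | _, .sym ⟨0, _⟩ =>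
      change quantRank newVertexF ≤ _
      omega
    | _, .sym ⟨1, _⟩ =>
      refine (quantRank_newHyperedgeF_le p.unpair.1 p.unpair.2).trans ?_
      omega
    | _, .sym ⟨2, _⟩ =>
      refine (quantRank_newInF p.unpair.2).trans_le ?_
      omega
  · cases F with
    | zero =>
      change quantRank (pairZeroF (σ := hyperVocab)) ≤ _
      omega
    | succ =>
      change quantRank (pairSuccF (σ := hyperVocab)) ≤ _
      omega

/-- The sentences of the reduction: the parameter remains the same. -/
def sameParam (p p' : ℕ) : (arithLang hyperVocab).Sentence := if p = p' then ⊤ else ⊥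

theorem models_sameParam (A : Struc hyperVocab) (p p' : ℕ) :
    A.carrier ⊨ sameParam p p' ↔ p = p' := by
  unfold sameParam Sentence.Realize Formula.Realize
  split_ifs with h <;> simp [h]

theorem computable_sameParam : Computable₂ fun p p' => formulaCode (sameParam p p') := by
  refine (Primrec.of_eq (Primrec.ite (c := fun q : ℕ × ℕ => q.1 = q.2)
    (Primrec.eq.comp Primrec.fst Primrec.snd)
    (Primrec.const (formulaCode (⊤ : (arithLang hyperVocab).Sentence)))
    (Primrec.const (formulaCode (⊥ : (arithLang hyperVocab).Sentence)))) fun q => ?_).to_comp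
  dsimp only
  unfold sameParam
  split_ifs <;> rfl

theorem quantRank_sameParam (p p' : ℕ) : quantRank (sameParam p p') = 0 := by
  unfold sameParam
  split_ifs <;> rfl

/-- The bounded rank reduction from hitting set to its restriction to structures in which all subsets
of hyperedges are represented. -/
def closureReduction : BoundedRankReduction hittingSet hittingSet' where
  f := closureQuery
  ι := sameParam
  computable_f := computableQueries_closureQuery
  computable_ι := computable_sameParam
  existsUnique_param A p := by
    simp only [models_sameParam]
    exact ⟨p, rfl, fun _ h => h.symm⟩
  param_le := ⟨id, Computable.id, fun A p p' h => ((models_sameParam A p p').1 h).ge⟩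
  correct A p p' h := by
    obtain rfl := (models_sameParam A p p').1 h
    exact closureQuery_correct A p
  bounded := by
    obtain ⟨c, hc⟩ := exists_quantRank_closureQuery_le
    refine ⟨max c 2, fun p p' => (quantRank_sameParam p p').trans_le (Nat.zero_le _), fun p =>
      ⟨le_max_right _ _, (hc p).1.trans (le_max_left _ _), fun n R => ?_, fun n F => ?_⟩⟩
    · exact ((hc p).2.1 n R).trans (le_max_left _ _)
    · exact ((hc p).2.2 n F).trans (le_max_left _ _)

theorem mainTheorem10 :
    ∃ R : BoundedRankReduction hittingSet hittingSet', ∀ p : ℕ, (R.f p).width = 2 :=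
  ⟨closureReduction, fun _ => rfl⟩
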